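/- Let $X$ be a finite group, $G\subset X$ a subgroup, and $M\subset X$ a set of left coset representatives with $e\in M$: every $x\in X$ factors uniquely as $x=us$ with $u\in G$, $s\in M$. For $s,t\in M$ and $u\in G$ define $\tau(s,t),\ s\triangleright u\in G$ and $s\cdot t,\ s\triangleleft u\in M$ by the unique factorisations $st=\tau(s,t)(s\cdot t)$ and $su=(s\triangleright u)(s\triangleleft u)$. Let $k$ be a field. Let $\mathcal D$ be the category whose objects are finite dimensional $k$-vector spaces $V$ with a decomposition $V=\bigoplus_{s\in M,\,u\in G}V_{s,u}$ (for $\xi\in V_{s,u}$ write $\langle\xi\rangle=s$, $|\xi|=u$), a linear right action $\bar\triangleleft$ of $G$, and linear maps $t\,\bar\triangleright:V\to V$ for $t\in M$, such that for all homogeneous $\eta,\kappa$ and all $s,t,p\in M$, $u\in G$: 1. $\langle\eta\bar\triangleleft u\rangle=\langle\eta\rangle\triangleleft u$ and $|\eta\bar\triangleleft u|=(\langle\eta\rangle\triangleright u)^{-1}|\eta|u$; 2. $s\bar\triangleright\eta$ is homogeneous, with $s\cdot\langle\eta\rangle=\langle s\bar\triangleright\eta\rangle\cdot(s\triangleleft|\eta|)$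 and $\tau(s,\langle\eta\rangle)^{-1}(s\triangleright|\eta|)=\tau(\langle s\bar\triangleright\eta\rangle,s\triangleleft|\eta|)^{-1}|s\bar\triangleright\eta|$; 3. $e\bar\triangleright\kappa=\kappa$, and $p\bar\triangleright(t\bar\triangleright\kappa)=((p'\cdot t)\bar\triangleright\kappa)\bar\triangleleft\tau(p'\triangleleft(t\triangleright|\kappa|),t\triangleleft|\kappa|)^{-1}$ with $p'=p\triangleleft\tau(\langle t\bar\triangleright\kappa\rangle,t\triangleleft|\kappa|)\,\tau(t,\langle\kappa\rangle)^{-1}$; 4. $(s\bar\triangleright\eta)\bar\triangleleft((s\triangleleft|\eta|)\triangleright u)=(s\triangleleft(\langle\eta\rangle\triangleright u))\bar\triangleright(\eta\bar\triangleleft u)$. Morphisms are the linear maps preserving both gradings and commuting with $\bar\triangleleft$ and $\bar\triangleright$. For objects $V,W$ give the vector space $V\otimes W$ the structure determined on homogeneous elements by $$\langle\xi\otimes\eta\rangle=\langle\xi\rangle\cdot\langle\eta\rangle,\qquad |\xi\otimes\eta|=\tau(\langle\xi\rangle,\langle\eta\rangle)^{-1}|\xi||\eta|,\qquad (\xi\otimes\eta)\bar\triangleleft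 u=\xi\bar\triangleleft(\langle\eta\rangle\triangleright u)\otimes\eta\bar\triangleleft u,$$ $$(s\triangleleft\tau(\langle\xi\rangle,\langle\eta\rangle))\bar\triangleright(\xi\otimes\eta)=(s\bar\triangleright\xi)\bar\triangleleft\,\tau(s\triangleleft|\xi|,\langle\eta\rangle)\,\tau(\langle(s\triangleleft|\xi|)\bar\triangleright\eta\rangle,s\triangleleft|\xi||\eta|)^{-1}\otimes(s\triangleleft|\xi|)\bar\triangleright\eta,$$ and let $(\theta\otimes\phi)(\xi\otimes\eta)=\theta(\xi)\otimes\phi(\eta)$ for morphisms $\theta,\phi$. **Theorem.** The spaces $V\otimes W$ are objects of $\mathcal D$, the maps $\theta\otimes\phi$ are morphisms of $\mathcal D$, the field $k$ with grades $\langle 1\rangle=e$, $|1|=e$ and trivial actions is an object of $\mathcal D$, and with this tensor product, the unit object $k$ and the following structure maps $\mathcal D$ is a braided tensor category. For homogeneous elements these maps are $$\Phi:(U\otimes V)\otimes W\to U\otimes(V\otimes W),\quad \Phi((\xi\otimes\eta)\otimes\zeta)=\xi\bar\triangleleft\tau(\langle\eta\rangle,\langle\zeta\rangle)\otimes(\eta\otimes\zeta),$$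 $$l_V:V\to V\otimes k,\quad l_V(\xi)=\xi\otimes 1,\qquad r_V:V\to k\otimes V,\quad r_V(\xi)=1\otimes\xi,$$ $$\Psi:V\otimes W\to W\otimes V,\quad \Psi(\xi\otimes\eta)=\langle\xi\rangle\bar\triangleright\eta\otimes\xi\bar\triangleleft|\eta|.$$ That is, $\Phi$, $l$, $r$ and $\Psi$ are natural isomorphisms in $\mathcal D$, the associator $\Phi$ satisfies the pentagon identity and, with $l$ and $r$, the triangle identity, and the braiding $\Psi$ satisfies both hexagon identities. -/

import Mathlib

open CategoryTheory TensorProduct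

universe w u

namespace CosetBraiding

section Cosets

variable {X : Type w} [Group X]

/-- A set `M` of left coset representatives for the subgroup `G` of `X` which contains the
identity: every `x : X` factors uniquely as `x = u * s` with `u ∈ G` and `s ∈ M`. -/
structure LeftCosetReps (G : Subgroup X) where
  M : Set X
  isComplement : Subgroup.IsComplement (G : Set X) M
  one_mem : (1 : X) ∈ M

namespace LeftCosetReps

variable {G : Subgroup X} (R : LeftCosetReps G)

/-- The factor `u ∈ G` of the unique factorisation `x = u * s`. -/
noncomputable def groupPart (x : X) : G :=
  ⟨(R.isComplement.equiv x).1, (R.isComplement.equiv x).1.2⟩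

/-- The factor `s ∈ M` of the unique factorisation `x = u * s`. -/
noncomputable def repPart (x : X) : R.M := (R.isComplement.equiv x).2

/-- The identity of `X` as an element of `M`. -/
def e : R.M := ⟨1, R.one_mem⟩

/-- `s t = τ(s,t) (s · t)`: the cocycle `τ(s,t) ∈ G`. -/
noncomputable def tau (s t : R.M) : G := R.groupPart ((s : X) * t)

/-- `s t = τ(s,t) (s · t)`: the product `s · t ∈ M`. -/
noncomputable def dot (s t : R.M) : R.M := R.repPart ((s : X) * t)

/-- `s u = (s ▷ u) (s ◁ u)`: the element `s ▷ u ∈ G`. -/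
noncomputable def la (s : R.M) (u : G) : G := R.groupPart ((s : X) * u)

/-- `s u = (s ▷ u) (s ◁ u)`: the element `s ◁ u ∈ M`. -/
noncomputable def ra (s : R.M) (u : G) : R.M := R.repPart ((s : X) * u)

/-- The finite set `M`, for sums over it. -/
@[reducible] noncomputable def fintypeReps [Finite X] : Fintype R.M := Fintype.ofFinite _

/-- The finite group `G`, for sums over it. -/
@[reducible] noncomputable def fintypeSubgroup [Finite X] (G : Subgroup X) : Fintype G := Fintype.ofFinite _

end LeftCosetReps

end Cosets

section Grading

variable {k : Type u} [Field k]

/-- A family of submodules with a matching complete family of projections is an internal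
direct sum decomposition. -/
theorem isInternal_of_projections {ι : Type*} [Fintype ι] [DecidableEq ι] {V : Type*} [AddCommGroup V] [Module k V]
    (A : ι → Submodule k V) (p : ι → V →ₗ[k] V) (hmem : ∀ i v, p i v ∈ A i)
    (hself : ∀ i, ∀ v ∈ A i, p i v = v) (hne : ∀ i j, i ≠ j → ∀ v ∈ A j, p i v = 0)
    (hsum : ∑ i, p i = LinearMap.id) : DirectSum.IsInternal A := by
  rw [DirectSum.isInternal_submodule_iff_iSupIndep_and_iSup_eq_top]
  constructor
  · intro i
    rw [Submodule.disjoint_def]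
    intro v hv hv'
    have h0 : (⨆ j, ⨆ (_ : j ≠ i), A j) ≤ LinearMap.ker (p i) :=
      iSup₂_le fun j hj v hv => hne i j (Ne.symm hj) v hv
    rw [← hself i v hv]
    exact h0 hv'
  · rw [eq_top_iff]
    intro v _
    have : v = ∑ i, p i v := by
      simpa using (LinearMap.congr_fun hsum v).symm
    rw [this]
    exact Submodule.sum_mem _ fun i _ => Submodule.mem_iSup_of_mem i (hmem i v)

end Grading

section Objects

attribute [local instance] LeftCosetReps.fintypeReps LeftCosetReps.fintypeSubgroup

variable {X : Type w} [Group X] {G : Subgroup X}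

open Classical in
/-- The raw data of an object, before the compatibility conditions: a finite dimensional vector
space with a decomposition `V = ⨁ V_{s,u}` over `s ∈ M`, `u ∈ G`, maps `ξ ↦ ξ ◁̄ u` for `u ∈ G`
and maps `ξ ↦ t ▷̄ ξ` for `t ∈ M`. The membership `ξ ∈ V.gr s u` means that `ξ` is homogeneous
with `⟨ξ⟩ = s` and `|ξ| = u`. -/
structure Data (k : Type u) [Field k] (R : LeftCosetReps G) where
  carrier : Type u
  [addCommGroup : AddCommGroup carrier]
  [module : Module k carrier]
  [finiteDimensional : FiniteDimensional k carrier]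
  gr : R.M → G → Submodule k carrier
  isInternal : DirectSum.IsInternal fun i : R.M × G => gr i.1 i.2
  act : G → carrier →ₗ[k] carrier
  mact : R.M → carrier →ₗ[k] carrier

attribute [instance] Data.addCommGroup Data.module Data.finiteDimensional

namespace Data

variable {k : Type u} [Field k] {R : LeftCosetReps G}

instance : CoeSort (Data k R) (Type u) := ⟨Data.carrier⟩

open Classical in
/-- The projection of `V = ⨁ V_{s,u}` onto the summand with index `i = (s,u)`. -/
noncomputable def proj (V : Data k R) (i : R.M × G) : V →ₗ[k] V :=
  (V.gr i.1 i.2).subtype ∘ₗ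
    DirectSum.component k (R.M × G) (fun i => V.gr i.1 i.2) i ∘ₗ
      (LinearEquiv.ofBijective
        (DirectSum.coeLinearMap fun i : R.M × G => V.gr i.1 i.2) V.isInternal).symm.toLinearMap

/-- The compatibility conditions for objects of the category `𝒟`. -/
structure IsObject (V : Data k R) : Prop where
  act_one : ∀ ξ : V, V.act 1 ξ = ξ
  act_mul : ∀ (u v : G) (ξ : V), V.act (u * v) ξ = V.act v (V.act u ξ)
  /-- `⟨η ◁̄ u⟩ = ⟨η⟩ ◁ u` and `|η ◁̄ u| = (⟨η⟩ ▷ u)⁻¹ |η| u` -/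
  act_mem : ∀ (a : R.M) (g u : G), ∀ η ∈ V.gr a g,
    V.act u η ∈ V.gr (R.ra a u) ((R.la a u)⁻¹ * g * u)
  /-- `s · ⟨η⟩ = ⟨s ▷̄ η⟩ · (s ◁ |η|)` and
  `τ(s,⟨η⟩)⁻¹ (s ▷ |η|) = τ(⟨s ▷̄ η⟩, s ◁ |η|)⁻¹ |s ▷̄ η|` -/
  mact_mem : ∀ (s a : R.M) (g : G), ∀ η ∈ V.gr a g, ∃ (c : R.M) (h : G),
    V.mact s η ∈ V.gr c h ∧
    R.dot s a = R.dot c (R.ra s g) ∧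
    (R.tau s a)⁻¹ * R.la s g = (R.tau c (R.ra s g))⁻¹ * h
  /-- `e ▷̄ ξ = ξ`: without it `▷̄ = 0` would be allowed -/
  one_mact : ∀ ξ : V, V.mact R.e ξ = ξ
  /-- `p ▷̄ (t ▷̄ κ) = ((p' · t) ▷̄ κ) ◁̄ τ(p' ◁ (t ▷ |κ|), t ◁ |κ|)⁻¹` where
  `p' = p ◁ τ(⟨t ▷̄ κ⟩, t ◁ |κ|) τ(t,⟨κ⟩)⁻¹` -/
  mact_mact : ∀ (p t b c : R.M) (h h' : G), ∀ κ ∈ V.gr b h, V.mact t κ ∈ V.gr c h' →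
    ∀ p' : R.M, p' = R.ra p (R.tau c (R.ra t h) * (R.tau t b)⁻¹) →
    V.mact p (V.mact t κ) =
      V.act (R.tau (R.ra p' (R.la t h)) (R.ra t h))⁻¹ (V.mact (R.dot p' t) κ)
  /-- `(s ▷̄ η) ◁̄ ((s ◁ |η|) ▷ u) = (s ◁ (⟨η⟩ ▷ u)) ▷̄ (η ◁̄ u)` -/
  cross : ∀ (s a : R.M) (g u : G), ∀ η ∈ V.gr a g,
    V.act (R.la (R.ra s g) u) (V.mact s η) = V.mact (R.ra s (R.la a u)) (V.act u η)

section Projections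

open Classical in
theorem proj_mem (V : Data k R) (i : R.M × G) (v : V) : V.proj i v ∈ V.gr i.1 i.2 := by
  simp [proj]

open Classical in
theorem proj_of_mem (V : Data k R) (i j : R.M × G) (v : V) (hv : v ∈ V.gr j.1 j.2) :
    V.proj i v = if i = j then v else 0 := by
  have h : (LinearEquiv.ofBijective
      (DirectSum.coeLinearMap fun i : R.M × G => V.gr i.1 i.2) V.isInternal).symm v =
      DirectSum.lof k (R.M × G) (fun i => V.gr i.1 i.2) j ⟨v, hv⟩ := by
    rw [LinearEquiv.symm_apply_eq]
    exact (DirectSum.coeLinearMap_lof (fun i : R.M × G => V.gr i.1 i.2) j ⟨v, hv⟩).symm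
  simp only [proj, LinearMap.comp_apply, LinearEquiv.coe_coe, h]
  split_ifs with hij
  · subst hij
    simp [DirectSum.component.lof_self]
  · rw [DirectSum.component.of, dif_neg (Ne.symm hij)]
    simp

theorem sum_proj [Finite X] (V : Data k R) : ∑ i, V.proj i = LinearMap.id := by
  classical
  ext v
  have htop := (DirectSum.isInternal_submodule_iff_iSupIndep_and_iSup_eq_top _).1 V.isInternal
  have hv : v ∈ ⨆ i : R.M × G, V.gr i.1 i.2 := by rw [htop.2]; trivial
  induction hv using Submodule.iSup_induction' with
  | mem j v hv => simp [V.proj_of_mem _ j v hv]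
  | zero => simp
  | add v w _ _ hv hw => rw [map_add, map_add, hv, hw]

end Projections

variable [Finite X]

/-- The projection onto `⨁_u V_{c,u}`, the summand of grade `⟨ξ⟩ = c`. -/
noncomputable def mproj (V : Data k R) (c : R.M) : V →ₗ[k] V := ∑ g : G, V.proj (c, g)

/-- `⟨ξ ⊗ η⟩ = ⟨ξ⟩ · ⟨η⟩` and `|ξ ⊗ η| = τ(⟨ξ⟩,⟨η⟩)⁻¹ |ξ| |η|` -/
noncomputable def tensorGrade (R : LeftCosetReps G) (i j : R.M × G) : R.M × G :=
  (R.dot i.1 j.1, (R.tau i.1 j.1)⁻¹ * i.2 * j.2)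

/-- The homogeneous subspaces of `V ⊗ W`. -/
noncomputable def tensorGr (V W : Data k R) (s : R.M) (u : G) : Submodule k (V ⊗[k] W) :=
  ⨆ (i : R.M × G) (j : R.M × G) (_ : tensorGrade R i j = (s, u)),
    Submodule.map₂ (TensorProduct.mk k V W) (V.gr i.1 i.2) (W.gr j.1 j.2)

open Classical in
theorem tensor_isInternal (V W : Data k R) :
    DirectSum.IsInternal fun i : R.M × G => tensorGr V W i.1 i.2 := by
  have key : ∀ l l' : R.M × G, ∀ x ∈ tensorGr V W l'.1 l'.2,
      (∑ i, ∑ j, if tensorGrade R i j = l then TensorProduct.map (V.proj i) (W.proj j) else 0) x =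
        if l = l' then x else 0 := by
    intro l l' x hx
    have hle : tensorGr V W l'.1 l'.2 ≤ LinearMap.eqLocus
        (∑ i, ∑ j, if tensorGrade R i j = l then TensorProduct.map (V.proj i) (W.proj j) else 0)
        (if l = l' then LinearMap.id else 0) := by
      refine iSup_le fun i => iSup_le fun j => iSup_le fun hij => ?_
      rw [Submodule.map₂_le]
      intro v hv w hw
      have h : ∀ i' j' : R.M × G, (if tensorGrade R i' j' = l then
          TensorProduct.map (V.proj i') (W.proj j') else 0) (v ⊗ₜ[k] w) =
          if i' = i then (if j' = j then (if l = l' then v ⊗ₜ[k] w else 0) else 0) else 0 := by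
        intro i' j'
        by_cases hi : i' = i
        · by_cases hj : j' = j
          · subst hi hj
            have hij' : tensorGrade R i' j' = l' := hij
            rw [hij']
            by_cases hl : l = l'
            · subst hl
              simp [V.proj_of_mem _ i' v hv, W.proj_of_mem _ j' w hw]
            · simp [hl, Ne.symm hl]
          · split_ifs <;> simp [W.proj_of_mem _ j w hw, hj]
        · split_ifs <;> simp [V.proj_of_mem _ i v hv, hi]
      simp only [LinearMap.mem_eqLocus, LinearMap.sum_apply, TensorProduct.mk_apply, h]
      split_ifs <;> simp
    have := hle hx
    rw [LinearMap.mem_eqLocus] at this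
    rw [this]
    split_ifs <;> rfl
  refine isInternal_of_projections _ (fun l => ∑ i, ∑ j, if tensorGrade R i j = l then
      TensorProduct.map (V.proj i) (W.proj j) else 0) ?_ ?_ ?_ ?_
  · intro l x
    induction x using TensorProduct.induction_on with
    | zero => rw [map_zero]; exact zero_mem _
    | add x y hx hy => rw [map_add]; exact add_mem hx hy
    | tmul v w =>
      simp only [LinearMap.sum_apply]
      refine Submodule.sum_mem _ fun i _ => Submodule.sum_mem _ fun j _ => ?_
      split_ifs with h
      · refine Submodule.mem_iSup_of_mem i (Submodule.mem_iSup_of_mem j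
          (Submodule.mem_iSup_of_mem h ?_))
        exact Submodule.apply_mem_map₂ _ (V.proj_mem i v) (W.proj_mem j w)
      · exact zero_mem _
  · intro l x hx
    simpa using key l l x hx
  · intro l l' hl x hx
    simpa [hl] using key l l' x hx
  · have h1 : ∀ i j : R.M × G, (∑ l, if tensorGrade R i j = l then
        TensorProduct.map (V.proj i) (W.proj j) else 0) =
        TensorProduct.map (V.proj i) (W.proj j) := fun i j => by simp
    rw [Finset.sum_comm]
    have h2 : ∀ i : R.M × G, (∑ l, ∑ j, if tensorGrade R i j = l then
        TensorProduct.map (V.proj i) (W.proj j) else 0) =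
        TensorProduct.map (V.proj i) LinearMap.id := fun i => by
      rw [Finset.sum_comm, Finset.sum_congr rfl fun j _ => h1 i j, ← W.sum_proj]
      exact (map_sum (TensorProduct.mapBilinear (RingHom.id k) V W V W (V.proj i)) W.proj
        Finset.univ).symm
    rw [Finset.sum_congr rfl fun i _ => h2 i]
    have h3 := map_sum ((TensorProduct.mapBilinear (RingHom.id k) V W V W).flip LinearMap.id)
      V.proj Finset.univ
    rw [V.sum_proj] at h3
    exact h3.symm.trans TensorProduct.map_id

/-- The `G`-action on `V ⊗ W`, for homogeneous `η`:
`(ξ ⊗ η) ◁̄ u = ξ ◁̄ (⟨η⟩ ▷ u) ⊗ η ◁̄ u`. The sum runs over the possible values `b` of `⟨η⟩`. -/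
noncomputable def tensorAct (V W : Data k R) (u : G) : V ⊗[k] W →ₗ[k] V ⊗[k] W :=
  ∑ b : R.M, TensorProduct.map (V.act (R.la b u)) (W.act u ∘ₗ W.mproj b)

/-- The `M`-action on `V ⊗ W`, for homogeneous `η` and `κ`:
`t ▷̄ (η ⊗ κ) = (s ▷̄ η) ◁̄ τ(s ◁ |η|, ⟨κ⟩) τ(⟨(s ◁ |η|) ▷̄ κ⟩, s ◁ |η||κ|)⁻¹ ⊗ (s ◁ |η|) ▷̄ κ`,
where `t = s ◁ τ(⟨η⟩,⟨κ⟩)`. The sums run over the possible values `i` of `(⟨η⟩,|η|)`, `j` of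
`(⟨κ⟩,|κ|)` and `c` of `⟨(s ◁ |η|) ▷̄ κ⟩`. -/
noncomputable def tensorMact (V W : Data k R) (t : R.M) : V ⊗[k] W →ₗ[k] V ⊗[k] W :=
  ∑ i : R.M × G, ∑ j : R.M × G, ∑ c : R.M,
    let s : R.M := R.ra t (R.tau i.1 j.1)⁻¹
    TensorProduct.map
      (V.act (R.tau (R.ra s i.2) j.1 * (R.tau c (R.ra s (i.2 * j.2)))⁻¹) ∘ₗ V.mact s ∘ₗ V.proj i)
      (W.mproj c ∘ₗ W.mact (R.ra s i.2) ∘ₗ W.proj j)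

/-- The tensor product `V ⊗ W`. -/
noncomputable def tensor (V W : Data k R) : Data k R where
  carrier := V ⊗[k] W
  gr := tensorGr V W
  isInternal := tensor_isInternal V W
  act := tensorAct V W
  mact := tensorMact V W

open Classical in
theorem unit_isInternal (k : Type u) [Field k] (R : LeftCosetReps G) :
    DirectSum.IsInternal fun i : R.M × G =>
      (if i.1 = R.e ∧ i.2 = 1 then ⊤ else ⊥ : Submodule k k) := by
  refine isInternal_of_projections _
    (fun i => if i = (R.e, (1 : G)) then LinearMap.id else 0) ?_ ?_ ?_ ?_
  · intro i v
    by_cases hi : i.1 = R.e ∧ i.2 = 1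
    · rw [if_pos hi]
      exact Submodule.mem_top
    · rw [if_neg fun h => hi ⟨congrArg Prod.fst h, congrArg Prod.snd h⟩]
      exact zero_mem _
  · intro i v hv
    by_cases hi : i.1 = R.e ∧ i.2 = 1
    · simp [hi, Prod.ext_iff]
    · simp only [hi, if_false, Submodule.mem_bot] at hv
      simp [hv]
  · intro i j hij v hv
    by_cases hj : j.1 = R.e ∧ j.2 = 1
    · have : i ≠ (R.e, 1) := fun h => hij (h.trans (Prod.ext hj.1.symm hj.2.symm))
      simp [this]
    · simp only [hj, if_false, Submodule.mem_bot] at hv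
      simp [hv]
  · simp

open Classical in
/-- The field `k` with grades `e` and trivial actions. -/
noncomputable def unit (k : Type u) [Field k] (R : LeftCosetReps G) : Data k R where
  carrier := k
  gr s u := if s = R.e ∧ u = 1 then ⊤ else ⊥
  isInternal := unit_isInternal k R
  act _ := LinearMap.id
  mact _ := LinearMap.id

end Data

end Objects

section Category

variable {X : Type w} [Group X] {G : Subgroup X}

/-- Objects of the category `𝒟`. -/
structure D (k : Type u) [Field k] (R : LeftCosetReps G) where
  data : Data k R
  isObject : data.IsObject

variable {k : Type u} [Field k] {R : LeftCosetReps G}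

namespace D

instance : CoeSort (D k R) (Type u) := ⟨fun V => V.data.carrier⟩

/-- Morphisms of `𝒟`: linear maps preserving both gradings and both actions. -/
@[ext]
structure Hom (V W : D k R) where
  lin : V →ₗ[k] W
  map_gr : ∀ (s : R.M) (u : G), ∀ ξ ∈ V.data.gr s u, lin ξ ∈ W.data.gr s u
  map_act : ∀ (u : G) (ξ : V), lin (V.data.act u ξ) = W.data.act u (lin ξ)
  map_mact : ∀ (t : R.M) (ξ : V), lin (V.data.mact t ξ) = W.data.mact t (lin ξ)

instance : Category (D k R) where
  Hom := Hom
  id V := ⟨LinearMap.id, fun _ _ _ h => h, fun _ _ => rfl, fun _ _ => rfl⟩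
  comp f g := ⟨g.lin ∘ₗ f.lin, fun s u ξ h => g.map_gr s u _ (f.map_gr s u ξ h),
    fun u ξ => by simp [f.map_act, g.map_act], fun t ξ => by simp [f.map_mact, g.map_mact]⟩

/-- The linear map underlying a morphism of `𝒟`. -/
def linear {V W : D k R} (f : V ⟶ W) : V →ₗ[k] W := Hom.lin f

end D

end Category

section BraidedData

/-- The data of a braided tensor category, without its axioms. -/
structure BraidedData (C : Type*) [Category C] extends MonoidalCategoryStruct C where
  braiding : ∀ V W : C, tensorObj V W ≅ tensorObj W V

/-- The data underlying a braided tensor category. -/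
def BraidedData.of (C : Type*) [Category C] [m : MonoidalCategory C] [b : BraidedCategory C] :
    BraidedData C where
  toMonoidalCategoryStruct := m.toMonoidalCategoryStruct
  braiding := b.braiding

end BraidedData

end CosetBraiding

open CosetBraiding

/-!
An object of `𝒟` is the same thing as a crossed `X`-module: for the `X`-grading `‖ξ‖ = |ξ|⁻¹ ⟨ξ⟩`
the actions of `G` and `M` assemble to a representation `ρ` of `X` with `‖ρ(y) ξ‖ = y ‖ξ‖ y⁻¹`,
from which they are recovered as `ξ ◁̄ u = ρ(u⁻¹) ξ` and `s ▷̄ ξ = ρ(s ◁ |ξ|) ξ`. The tensor product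
becomes the usual one after the substitution `ξ ⊠ η = ρ(|η|) ξ ⊗ η`, since `‖ξ ⊠ η‖ = ‖ξ‖ ‖η‖` and
`ρ(y) (ξ ⊠ η) = ρ(y) ξ ⊠ ρ(y) η`. On such elements the structure maps lose their cocycles,
`Φ((ξ ⊠ η) ⊠ ζ) = ξ ⊠ (η ⊠ ζ)` and `Ψ(ξ ⊠ η) = ρ(‖ξ‖) η ⊠ ξ`, and the coherence identities are
those of the standard braiding of crossed modules.
-/

namespace CosetBraiding

namespace LeftCosetReps

variable {X : Type w} [Group X] {G : Subgroup X} (R : LeftCosetReps G)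

theorem groupPart_mul_repPart (x : X) : (R.groupPart x : X) * R.repPart x = x :=
  R.isComplement.equiv_fst_mul_equiv_snd x

variable {R} in
theorem coe_mul_coe_inj {u v : G} {s t : R.M} : (u : X) * s = v * t ↔ u = v ∧ s = t := by
  have inj := R.isComplement.1.eq_iff (a := (⟨u, u.2⟩, s)) (b := (⟨v, v.2⟩, t))
  simpa only [Prod.mk.injEq, Subtype.mk.injEq, SetLike.coe_eq_coe] using inj

theorem groupPart_eq {x : X} {u : G} {s : R.M} (h : (u : X) * s = x) : R.groupPart x = u :=
  (coe_mul_coe_inj.1 ((R.groupPart_mul_repPart x).trans h.symm)).1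

theorem repPart_eq {x : X} {u : G} {s : R.M} (h : (u : X) * s = x) : R.repPart x = s :=
  (coe_mul_coe_inj.1 ((R.groupPart_mul_repPart x).trans h.symm)).2

@[simp]
theorem groupPart_coe_mul_coe (u : G) (s : R.M) : R.groupPart ((u : X) * s) = u :=
  R.groupPart_eq rfl

@[simp]
theorem repPart_coe_mul_coe (u : G) (s : R.M) : R.repPart ((u : X) * s) = s :=
  R.repPart_eq rfl

@[simp]
theorem coe_e : (R.e : X) = 1 := rfl

@[simp]
theorem groupPart_rep (s : R.M) : R.groupPart (s : X) = 1 :=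
  R.groupPart_eq (one_mul _)

@[simp]
theorem repPart_rep (s : R.M) : R.repPart (s : X) = s :=
  R.repPart_eq (u := 1) (one_mul _)

@[simp]
theorem groupPart_subgroup (u : G) : R.groupPart (u : X) = u :=
  R.groupPart_eq (s := R.e) (mul_one _)

@[simp]
theorem repPart_subgroup (u : G) : R.repPart (u : X) = R.e :=
  R.repPart_eq (mul_one _)

theorem tau_mul_dot (s t : R.M) : (R.tau s t : X) * R.dot s t = s * t :=
  R.groupPart_mul_repPart _

theorem la_mul_ra (s : R.M) (u : G) : (R.la s u : X) * R.ra s u = s * u :=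
  R.groupPart_mul_repPart _

theorem coe_la_mul_la_mul_ra (s : R.M) (u v : G) :
    ((R.la s u * R.la (R.ra s u) v : G) : X) * R.ra (R.ra s u) v = s * (u * v : G) := by
  rw [Subgroup.coe_mul, mul_assoc, la_mul_ra, ← mul_assoc, la_mul_ra, mul_assoc, Subgroup.coe_mul]

theorem la_mul (s : R.M) (u v : G) : R.la s (u * v) = R.la s u * R.la (R.ra s u) v :=
  R.groupPart_eq (R.coe_la_mul_la_mul_ra s u v)

theorem ra_mul (s : R.M) (u v : G) : R.ra s (u * v) = R.ra (R.ra s u) v :=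
  R.repPart_eq (R.coe_la_mul_la_mul_ra s u v)

@[simp]
theorem la_one (s : R.M) : R.la s 1 = 1 := by simp [la]

@[simp]
theorem ra_one (s : R.M) : R.ra s 1 = s := by simp [ra]

@[simp]
theorem ra_inv_ra (s : R.M) (u : G) : R.ra (R.ra s u⁻¹) u = s := by
  rw [← ra_mul, inv_mul_cancel, ra_one]

theorem la_ra_inv (s : R.M) (u : G) : R.la (R.ra s u) u⁻¹ = (R.la s u)⁻¹ := by
  refine eq_inv_of_mul_eq_one_right ?_
  rw [← la_mul, mul_inv_cancel, la_one]

theorem dot_ra_la_ra (s t : R.M) (u : G) :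
    R.dot (R.ra s (R.la t u)) (R.ra t u) = R.ra (R.dot s t) u := by
  refine (R.repPart_eq (u := (R.tau s t)⁻¹ * R.la s (R.la t u) *
    R.tau (R.ra s (R.la t u)) (R.ra t u)) ?_).symm
  rw [Subgroup.coe_mul, mul_assoc, tau_mul_dot, Subgroup.coe_mul, mul_assoc,
    ← mul_assoc (R.la s _ : X), la_mul_ra, mul_assoc, la_mul_ra, ← mul_assoc (s : X), ← tau_mul_dot]
  simp [mul_assoc]

theorem tensor_degree (a b : R.M) (g h : G) :
    (((R.tau a b)⁻¹ * g * h : G) : X)⁻¹ * R.dot a b = (h : X)⁻¹ * ((g : X)⁻¹ * a) * b := by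
  simp only [Subgroup.coe_mul, Subgroup.coe_inv, mul_inv_rev, inv_inv, mul_assoc, tau_mul_dot]

theorem coe_mul_dot_repPart (x y : X) :
    ((R.groupPart x * R.la (R.repPart x) (R.groupPart y) *
        R.tau (R.ra (R.repPart x) (R.groupPart y)) (R.repPart y) : G) : X) *
      R.dot (R.ra (R.repPart x) (R.groupPart y)) (R.repPart y) = x * y := by
  rw [Subgroup.coe_mul, mul_assoc, tau_mul_dot, Subgroup.coe_mul, mul_assoc,
    ← mul_assoc (R.la _ _ : X), la_mul_ra, mul_assoc, groupPart_mul_repPart, ← mul_assoc,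
    groupPart_mul_repPart]

theorem groupPart_mul (x y : X) :
    R.groupPart (x * y) = R.groupPart x * R.la (R.repPart x) (R.groupPart y) *
      R.tau (R.ra (R.repPart x) (R.groupPart y)) (R.repPart y) :=
  R.groupPart_eq (R.coe_mul_dot_repPart x y)

theorem repPart_mul (x y : X) :
    R.repPart (x * y) = R.dot (R.ra (R.repPart x) (R.groupPart y)) (R.repPart y) :=
  R.repPart_eq (R.coe_mul_dot_repPart x y)

theorem conj_ra_eq_iff (s a c : R.M) (g h : G) :
    (h : X)⁻¹ * c = R.ra s g * ((g : X)⁻¹ * a) * (R.ra s g : X)⁻¹ ↔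
      R.dot s a = R.dot c (R.ra s g) ∧
        (R.tau s a)⁻¹ * R.la s g = (R.tau c (R.ra s g))⁻¹ * h := by
  have lhs : ((h⁻¹ * R.tau c (R.ra s g) : G) : X) * R.dot c (R.ra s g) =
      (h : X)⁻¹ * c * R.ra s g := by
    rw [Subgroup.coe_mul, mul_assoc, tau_mul_dot, ← mul_assoc, Subgroup.coe_inv]
  have rhs : (((R.la s g)⁻¹ * R.tau s a : G) : X) * R.dot s a =
      R.ra s g * ((g : X)⁻¹ * a) := by
    rw [Subgroup.coe_mul, mul_assoc, tau_mul_dot, Subgroup.coe_inv, inv_mul_eq_iff_eq_mul,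
      ← mul_assoc, la_mul_ra]
    group
  rw [eq_mul_inv_iff_mul_eq, ← lhs, ← rhs, coe_mul_coe_inj, and_comm, eq_comm (b := R.dot s a),
    ← inv_inj (a := h⁻¹ * _), mul_inv_rev, mul_inv_rev, inv_inv, inv_inv,
    eq_comm (b := _ * R.la s g)]

@[simp]
theorem e_ra (u : G) : R.ra R.e u = R.e := by simp [ra]

/-- The homomorphism from `X` to a monoid assembled from a homomorphism `α` on `G` and a map `σ` on
`M` that satisfy the relations `st = τ(s,t)(s · t)` and `su = (s ▷ u)(s ◁ u)` of `X`. -/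
noncomputable def lift {E : Type*} [Monoid E] (α : G →* E) (σ : R.M → E) (map_e : σ R.e = 1)
    (map_ra : ∀ s u, σ s * α u = α (R.la s u) * σ (R.ra s u))
    (map_dot : ∀ s t, σ s * σ t = α (R.tau s t) * σ (R.dot s t)) : X →* E where
  toFun x := α (R.groupPart x) * σ (R.repPart x)
  map_one' := by
    have hg := R.groupPart_subgroup 1
    have hr := R.repPart_subgroup 1
    rw [Subgroup.coe_one] at hg hr
    rw [hg, hr, map_one, map_e, one_mul]
  map_mul' x y := by
    rw [groupPart_mul, repPart_mul, map_mul, map_mul, mul_assoc, ← map_dot, mul_assoc,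
      ← mul_assoc (α (R.la _ _)), ← map_ra]
    simp only [mul_assoc]

section Lift

variable {E : Type*} [Monoid E] {α : G →* E} {σ : R.M → E} {map_e : σ R.e = 1}
  {map_ra : ∀ s u, σ s * α u = α (R.la s u) * σ (R.ra s u)}
  {map_dot : ∀ s t, σ s * σ t = α (R.tau s t) * σ (R.dot s t)}

theorem lift_apply (x : X) :
    R.lift α σ map_e map_ra map_dot x = α (R.groupPart x) * σ (R.repPart x) := rfl

theorem lift_subgroup (u : G) : R.lift α σ map_e map_ra map_dot u = α u := by
  rw [lift_apply, groupPart_subgroup, repPart_subgroup, map_e, mul_one]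

theorem lift_rep (s : R.M) : R.lift α σ map_e map_ra map_dot s = σ s := by
  rw [lift_apply, groupPart_rep, repPart_rep, map_one, one_mul]

end Lift

end LeftCosetReps

attribute [local instance] LeftCosetReps.fintypeReps LeftCosetReps.fintypeSubgroup

section Grading

variable {X : Type w} [Group X] {G : Subgroup X} {k : Type u} [Field k] {R : LeftCosetReps G}

namespace Data

/-- The elements of degree `‖ξ‖ = x` for the `X`-grading `‖ξ‖ = |ξ|⁻¹ ⟨ξ⟩`. -/
noncomputable def homog (V : Data k R) (x : X) : Submodule k V :=
  V.gr (R.repPart x) (R.groupPart x)⁻¹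

theorem gr_eq_homog (V : Data k R) (a : R.M) (g : G) : V.gr a g = V.homog ((g : X)⁻¹ * a) := by
  rw [homog, ← Subgroup.coe_inv, R.groupPart_coe_mul_coe, R.repPart_coe_mul_coe, inv_inv]

variable {V : Data k R}

theorem mem_homog_of_mem_gr {a : R.M} {g : G} {ξ : V} (hξ : ξ ∈ V.gr a g) :
    ξ ∈ V.homog ((g : X)⁻¹ * a) :=
  V.gr_eq_homog a g ▸ hξ

theorem eq_of_mem_homog {x y : X} {ξ : V} (hx : ξ ∈ V.homog x) (hy : ξ ∈ V.homog y)
    (h0 : ξ ≠ 0) : x = y := by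
  classical
  let i : X → R.M × G := fun x => (R.repPart x, (R.groupPart x)⁻¹)
  have hproj := (V.proj_of_mem (i x) (i x) ξ hx).symm.trans (V.proj_of_mem (i x) (i y) ξ hy)
  rw [if_pos rfl] at hproj
  split_ifs at hproj with hxy
  · rw [Prod.mk.injEq, inv_inj] at hxy
    rw [← R.groupPart_mul_repPart x, hxy.1, hxy.2, R.groupPart_mul_repPart]
  · exact absurd hproj h0

variable [Finite X]

theorem homog_induction {p : V → Prop} (ξ : V) (homog : ∀ x, ∀ ξ ∈ V.homog x, p ξ)
    (add : ∀ ξ η, p ξ → p η → p (ξ + η)) : p ξ := by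
  have hsum : ∑ i, V.proj i ξ = ξ := by
    rw [← LinearMap.sum_apply, V.sum_proj, LinearMap.id_apply]
  rw [← hsum]
  exact Finset.sum_induction _ p add (homog 1 0 (zero_mem _))
    fun i _ => homog _ _ (mem_homog_of_mem_gr (V.proj_mem i ξ))

variable {Z : Type*} [AddCommGroup Z] [Module k Z]

theorem linearMap_ext_homog {f g : V →ₗ[k] Z} (h : ∀ x, ∀ ξ ∈ V.homog x, f ξ = g ξ) : f = g :=
  LinearMap.ext fun ξ => homog_induction ξ h fun ξ η hξ hη => by rw [map_add, map_add, hξ, hη]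

/-- The linear map that is `f s u` on the summand `V_{s,u}`. -/
noncomputable def piecewise (V : Data k R) (f : R.M → G → V →ₗ[k] Z) : V →ₗ[k] Z :=
  ∑ i : R.M × G, f i.1 i.2 ∘ₗ V.proj i

theorem piecewise_apply (f : R.M → G → V →ₗ[k] Z) {a : R.M} {g : G} {ξ : V} (hξ : ξ ∈ V.gr a g) :
    V.piecewise f ξ = f a g ξ := by
  classical
  rw [piecewise, LinearMap.sum_apply, Finset.sum_eq_single (a, g)]
  · rw [LinearMap.comp_apply, V.proj_of_mem _ (a, g) ξ hξ, if_pos rfl]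
  · intro i _ hi
    rw [LinearMap.comp_apply, V.proj_of_mem _ (a, g) ξ hξ, if_neg hi, map_zero]
  · simp

variable {W : Type*} [AddCommGroup W] [Module k W]

/-- The map `ξ ⊗ η ↦ ξ ⊗ σ(f ⟨ξ⟩ |ξ|) η`. -/
noncomputable def gradedActHom (V : Data k R) (σ : Representation k X W) (f : R.M → G → X) :
    V ⊗[k] W →ₗ[k] V ⊗[k] W :=
  TensorProduct.lift (V.piecewise fun a g => (TensorProduct.mk k V W).compl₂ (σ (f a g)))

theorem gradedActHom_tmul (σ : Representation k X W) (f : R.M → G → X) {a : R.M} {g : G} {ξ : V}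
    (hξ : ξ ∈ V.gr a g) (η : W) : V.gradedActHom σ f (ξ ⊗ₜ η) = ξ ⊗ₜ σ (f a g) η := by
  rw [gradedActHom, TensorProduct.lift.tmul, piecewise_apply _ hξ]
  rfl

theorem gradedActHom_comp_of_mul_eq_one (σ : Representation k X W) {f f' : R.M → G → X}
    (h : ∀ a g, f a g * f' a g = 1) :
    V.gradedActHom σ f ∘ₗ V.gradedActHom σ f' = LinearMap.id := by
  refine TensorProduct.ext (linearMap_ext_homog fun x ξ hξ => LinearMap.ext fun η => ?_)
  change V.gradedActHom σ f (V.gradedActHom σ f' (ξ ⊗ₜ η)) = ξ ⊗ₜ η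
  rw [gradedActHom_tmul σ f' hξ, gradedActHom_tmul σ f hξ, ← Module.End.mul_apply, ← map_mul, h,
    map_one, Module.End.one_apply]

/-- The automorphism `ξ ⊗ η ↦ ξ ⊗ σ(f ⟨ξ⟩ |ξ|) η`. -/
noncomputable def gradedAct (V : Data k R) (σ : Representation k X W) (f : R.M → G → X) :
    V ⊗[k] W ≃ₗ[k] V ⊗[k] W :=
  LinearEquiv.ofLinearMap (V.gradedActHom σ f) (V.gradedActHom σ fun a g => (f a g)⁻¹)
    (gradedActHom_comp_of_mul_eq_one σ fun _ _ => mul_inv_cancel _)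
    (gradedActHom_comp_of_mul_eq_one σ fun _ _ => inv_mul_cancel _)

theorem gradedAct_tmul (σ : Representation k X W) (f : R.M → G → X) {a : R.M} {g : G} {ξ : V}
    (hξ : ξ ∈ V.gr a g) (η : W) : V.gradedAct σ f (ξ ⊗ₜ η) = ξ ⊗ₜ σ (f a g) η :=
  gradedActHom_tmul σ f hξ η

end Data

end Grading

section Crossed

variable {X : Type w} [Group X] {G : Subgroup X} {k : Type u} [Field k] {R : LeftCosetReps G}

namespace Data

/-- The representation `ρ` of `X` makes `V` a crossed `X`-module for the grading `‖ξ‖`, and the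
actions of `G` and `M` are recovered from it as `ξ ◁̄ u = ρ(u⁻¹) ξ` and `s ▷̄ ξ = ρ(s ◁ |ξ|) ξ`. -/
structure IsCrossed (V : Data k R) (ρ : Representation k X V) : Prop where
  act_eq : ∀ (u : G) (ξ : V), V.act u ξ = ρ (u : X)⁻¹ ξ
  mact_eq : ∀ (s a : R.M) (g : G), ∀ ξ ∈ V.gr a g, V.mact s ξ = ρ (R.ra s g) ξ
  mem : ∀ (y x : X), ∀ ξ ∈ V.homog x, ρ y ξ ∈ V.homog (y * x * y⁻¹)

variable {V : Data k R}

theorem IsObject.act_mem_homog (hV : V.IsObject) (u : G) {x : X} {ξ : V} (hξ : ξ ∈ V.homog x) :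
    V.act u ξ ∈ V.homog ((u : X)⁻¹ * x * u) := by
  have hmem := mem_homog_of_mem_gr (hV.act_mem _ _ u ξ hξ)
  simp only [Subgroup.coe_mul, mul_inv_rev, Subgroup.coe_inv, inv_inv, mul_assoc, R.la_mul_ra]
    at hmem
  rwa [← mul_assoc (R.groupPart x : X), R.groupPart_mul_repPart, ← mul_assoc] at hmem

theorem IsObject.mact_mem_homog (hV : V.IsObject) (s : R.M) {a : R.M} {g : G} {ξ : V}
    (hξ : ξ ∈ V.gr a g) :
    V.mact s ξ ∈ V.homog (R.ra s g * ((g : X)⁻¹ * a) * (R.ra s g : X)⁻¹) := by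
  obtain ⟨c, h, hmem, hdot, htau⟩ := hV.mact_mem s a g ξ hξ
  rw [← (R.conj_ra_eq_iff s a c g h).2 ⟨hdot, htau⟩]
  exact mem_homog_of_mem_gr hmem

/-- The action `ξ ↦ ξ ◁̄ u⁻¹` of `u ∈ G`, as a left action. -/
def IsObject.groupAct (hV : V.IsObject) : Representation k G V where
  toFun u := V.act u⁻¹
  map_one' := LinearMap.ext fun ξ => by rw [inv_one, hV.act_one, Module.End.one_apply]
  map_mul' u v := LinearMap.ext fun ξ => by rw [mul_inv_rev, hV.act_mul, Module.End.mul_apply]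

theorem IsObject.groupAct_apply (hV : V.IsObject) (u : G) (ξ : V) :
    hV.groupAct u ξ = V.act u⁻¹ ξ := rfl

variable {ρ : Representation k X V}

theorem IsCrossed.act_mem_gr (hρ : V.IsCrossed ρ) (u : G) {a : R.M} {g : G} {ξ : V}
    (hξ : ξ ∈ V.gr a g) : V.act u ξ ∈ V.gr (R.ra a u) ((R.la a u)⁻¹ * g * u) := by
  have hmem := hρ.mem (u : X)⁻¹ _ ξ (mem_homog_of_mem_gr hξ)
  rw [hρ.act_eq, gr_eq_homog]
  convert hmem using 2
  simp only [Subgroup.coe_mul, Subgroup.coe_inv, mul_inv_rev, inv_inv, mul_assoc, R.la_mul_ra]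

theorem IsCrossed.mact_mem_homog (hρ : V.IsCrossed ρ) (s : R.M) {a : R.M} {g : G} {ξ : V}
    (hξ : ξ ∈ V.gr a g) :
    V.mact s ξ ∈ V.homog (R.ra s g * ((g : X)⁻¹ * a) * (R.ra s g : X)⁻¹) := by
  rw [hρ.mact_eq s a g ξ hξ]
  exact hρ.mem _ _ ξ (mem_homog_of_mem_gr hξ)

theorem IsCrossed.mact_mact (hρ : V.IsCrossed ρ) {p t b c : R.M} {h h' : G} {κ : V}
    (hκ : κ ∈ V.gr b h) (hκ' : V.mact t κ ∈ V.gr c h') {p' : R.M}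
    (hp' : p' = R.ra p (R.tau c (R.ra t h) * (R.tau t b)⁻¹)) :
    V.mact p (V.mact t κ) =
      V.act (R.tau (R.ra p' (R.la t h)) (R.ra t h))⁻¹ (V.mact (R.dot p' t) κ) := by
  obtain rfl | h0 := eq_or_ne κ 0
  · simp only [map_zero]
  have h0' : V.mact t κ ≠ 0 := by
    rw [hρ.mact_eq t b h κ hκ]
    exact (map_ne_zero_iff _ (ρ.apply_bijective _).injective).2 h0
  obtain ⟨-, htau⟩ := (R.conj_ra_eq_iff t b c h h').1
    (eq_of_mem_homog (mem_homog_of_mem_gr hκ') (hρ.mact_mem_homog t hκ) h0')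
  have hp : R.ra p' (R.la t h) = R.ra p h' := by
    rw [hp', ← R.ra_mul, mul_assoc, htau, mul_inv_cancel_left]
  rw [hρ.mact_eq p c h' _ hκ', hρ.mact_eq t b h κ hκ, hρ.mact_eq _ b h κ hκ, hρ.act_eq, hp,
    ← Module.End.mul_apply, ← Module.End.mul_apply, ← map_mul, ← map_mul, ← R.dot_ra_la_ra, hp,
    Subgroup.coe_inv, inv_inv, R.tau_mul_dot]

variable [Finite X]

/-- The action by which `s ∈ M ⊆ X` enters the representation of `X` on an object:
`ξ ↦ (s ◁ |ξ|⁻¹) ▷̄ ξ`. -/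
noncomputable def repAct (V : Data k R) (s : R.M) : Module.End k V :=
  V.piecewise fun _ g => V.mact (R.ra s g⁻¹)

theorem repAct_apply (s : R.M) {a : R.M} {g : G} {ξ : V} (hξ : ξ ∈ V.gr a g) :
    V.repAct s ξ = V.mact (R.ra s g⁻¹) ξ :=
  piecewise_apply _ hξ

namespace IsObject

theorem repAct_mem_homog (hV : V.IsObject) (s : R.M) {x : X} {ξ : V} (hξ : ξ ∈ V.homog x) :
    V.repAct s ξ ∈ V.homog (s * x * (s : X)⁻¹) := by
  have hmem := hV.mact_mem_homog (R.ra s (R.groupPart x)⁻¹⁻¹) hξ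
  rwa [R.ra_inv_ra, Subgroup.coe_inv, inv_inv, R.groupPart_mul_repPart, ← repAct_apply s hξ]
    at hmem

theorem repAct_e (hV : V.IsObject) : V.repAct R.e = 1 :=
  linearMap_ext_homog fun x ξ hξ => by
    rw [repAct_apply _ hξ, R.e_ra, hV.one_mact, Module.End.one_apply]

theorem repAct_mul_groupAct (hV : V.IsObject) (s : R.M) (u : G) :
    V.repAct s * hV.groupAct u = hV.groupAct (R.la s u) * V.repAct (R.ra s u) := by
  refine linearMap_ext_homog fun x ξ hξ => ?_
  set a := R.repPart x
  set g := (R.groupPart x)⁻¹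
  rw [Module.End.mul_apply, Module.End.mul_apply, groupAct_apply, groupAct_apply,
    repAct_apply s (hV.act_mem a g u⁻¹ ξ hξ), repAct_apply (a := a) (g := g) _ hξ,
    ← R.la_ra_inv s u]
  have hcross := hV.cross (R.ra (R.ra s u) g⁻¹) a g u⁻¹ ξ hξ
  rw [R.ra_inv_ra (R.ra s u)] at hcross
  rw [hcross, ← R.ra_mul, ← R.ra_mul]
  simp only [mul_inv_rev, inv_inv, mul_assoc]

theorem repAct_mul_repAct (hV : V.IsObject) (s t : R.M) :
    V.repAct s * V.repAct t = hV.groupAct (R.tau s t) * V.repAct (R.dot s t) := by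
  refine linearMap_ext_homog fun x ξ hξ => ?_
  set a := R.repPart x
  set g := (R.groupPart x)⁻¹
  obtain ⟨c, h, hmem, -, htau⟩ := hV.mact_mem (R.ra t g⁻¹) a g ξ hξ
  set t₀ := R.ra t g⁻¹
  have ht : R.ra t₀ g = t := R.ra_inv_ra t g
  set p := R.ra s h⁻¹ with hp
  set p' := R.ra p (R.tau c (R.ra t₀ g) * (R.tau t₀ a)⁻¹) with hp'
  have hs : R.ra p' (R.la t₀ g) = s := by
    rw [hp', ← R.ra_mul, mul_assoc, htau, mul_inv_cancel_left, hp, R.ra_inv_ra]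
  have hdot' : R.ra (R.dot s t) g⁻¹ = R.dot p' t₀ := by
    rw [← ht, ← hs, R.dot_ra_la_ra, ← R.ra_mul, mul_inv_cancel, R.ra_one]
  rw [Module.End.mul_apply, Module.End.mul_apply, groupAct_apply, repAct_apply t hξ,
    repAct_apply s hmem, repAct_apply _ hξ, hV.mact_mact p t₀ a c g h ξ hξ hmem p' hp', hs, ht,
    hdot']

/-- The representation of `X` on an object. -/
noncomputable def rho (hV : V.IsObject) : Representation k X V :=
  R.lift hV.groupAct V.repAct hV.repAct_e hV.repAct_mul_groupAct hV.repAct_mul_repAct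

theorem isCrossed (hV : V.IsObject) : V.IsCrossed hV.rho where
  act_eq u ξ := by
    rw [rho, ← Subgroup.coe_inv, R.lift_subgroup, groupAct_apply, inv_inv]
  mact_eq s a g ξ hξ := by
    rw [rho, R.lift_rep, repAct_apply _ hξ, ← R.ra_mul, mul_inv_cancel, R.ra_one]
  mem y x ξ hξ := by
    rw [rho, R.lift_apply, Module.End.mul_apply, groupAct_apply]
    have hmem := hV.act_mem_homog (R.groupPart y)⁻¹ (hV.repAct_mem_homog (R.repPart y) hξ)
    have hy : (((R.groupPart y)⁻¹ : G) : X)⁻¹ * (R.repPart y * x * (R.repPart y : X)⁻¹) *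
        ((R.groupPart y)⁻¹ : G) = y * x * y⁻¹ := by
      conv_rhs => rw [← R.groupPart_mul_repPart y]
      simp only [Subgroup.coe_inv, inv_inv, mul_inv_rev, mul_assoc]
    rwa [hy] at hmem

end IsObject

namespace IsCrossed

theorem eq {ρ' : Representation k X V} (hρ : V.IsCrossed ρ) (hρ' : V.IsCrossed ρ') : ρ = ρ' := by
  have on_group (u : G) : ρ u = ρ' u := by
    rw [← inv_inv (u : X), ← Subgroup.coe_inv]
    exact LinearMap.ext fun ξ => by rw [← hρ.act_eq, hρ'.act_eq]
  have on_reps (s : R.M) : ρ s = ρ' s :=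
    linearMap_ext_homog fun x ξ hξ => by
      rw [← R.ra_inv_ra s (R.groupPart x)⁻¹, ← hρ.mact_eq _ _ _ ξ hξ, hρ'.mact_eq _ _ _ ξ hξ]
  ext1 x
  rw [← R.groupPart_mul_repPart x, map_mul, map_mul, on_group, on_reps]

theorem isObject (hρ : V.IsCrossed ρ) : V.IsObject where
  act_one ξ := by
    rw [hρ.act_eq, Subgroup.coe_one, inv_one, map_one, Module.End.one_apply]
  act_mul u v ξ := by
    simp only [hρ.act_eq, Subgroup.coe_mul, mul_inv_rev, map_mul, Module.End.mul_apply]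
  act_mem a g u ξ hξ := hρ.act_mem_gr u hξ
  mact_mem s a g ξ hξ :=
    ⟨_, _, hρ.mact_mem_homog s hξ, (R.conj_ra_eq_iff s a _ g _).1 (by
      rw [Subgroup.coe_inv, inv_inv, R.groupPart_mul_repPart])⟩
  one_mact ξ := by
    induction ξ using homog_induction with
    | add ξ η hξ hη => rw [map_add, hξ, hη]
    | homog x ξ hξ =>
      rw [hρ.mact_eq _ _ _ ξ hξ, R.e_ra, R.coe_e, map_one, Module.End.one_apply]
  mact_mact p t b c h h' κ hκ hκ' p' hp' := hρ.mact_mact hκ hκ' hp'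
  cross s a g u ξ hξ := by
    rw [hρ.mact_eq _ _ _ _ (hρ.act_mem_gr u hξ), hρ.mact_eq _ _ _ ξ hξ, hρ.act_eq, hρ.act_eq,
      ← Module.End.mul_apply, ← Module.End.mul_apply, ← map_mul, ← map_mul]
    congr 2
    rw [← R.ra_mul, mul_assoc, mul_inv_cancel_left, R.ra_mul, inv_mul_eq_iff_eq_mul, ← mul_assoc,
      eq_mul_inv_iff_mul_eq, R.la_mul_ra]

end IsCrossed

end Data

end Crossed

section Tensor

variable {X : Type w} [Group X] [Finite X] {G : Subgroup X} {k : Type u} [Field k]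
  {R : LeftCosetReps G}

namespace Data

theorem mproj_of_mem (V : Data k R) {a : R.M} {g : G} {ξ : V} (hξ : ξ ∈ V.gr a g) :
    V.mproj a ξ = ξ := by
  classical
  rw [mproj, LinearMap.sum_apply, Finset.sum_eq_single g]
  · rw [V.proj_of_mem _ (a, g) ξ hξ, if_pos rfl]
  · intro g' _ hg'
    rw [V.proj_of_mem _ (a, g) ξ hξ, if_neg (mt (congrArg Prod.snd) hg')]
  · simp

theorem mproj_of_mem_of_ne (V : Data k R) {a b : R.M} {g : G} {ξ : V} (hξ : ξ ∈ V.gr a g)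
    (hb : b ≠ a) : V.mproj b ξ = 0 := by
  classical
  rw [mproj, LinearMap.sum_apply]
  refine Finset.sum_eq_zero fun g' _ => ?_
  rw [V.proj_of_mem _ (a, g) ξ hξ, if_neg (mt (congrArg Prod.fst) hb)]

variable {V W : Data k R}

/-- The identity of `V ⊗ W`, with values in the carrier of `V.tensor W`. -/
noncomputable def tensorEquiv (V W : Data k R) : V ⊗[k] W ≃ₗ[k] V.tensor W :=
  LinearEquiv.refl k (V ⊗[k] W)

/-- The tensor `ξ ⊗ η` as an element of `V.tensor W`. -/
noncomputable def tmul : V →ₗ[k] W →ₗ[k] V.tensor W := TensorProduct.mk k V W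

theorem tensorEquiv_tmul (ξ : V) (η : W) : tensorEquiv V W (ξ ⊗ₜ η) = tmul ξ η := rfl

theorem tmul_mem_gr {a b : R.M} {g h : G} {ξ : V} {η : W} (hξ : ξ ∈ V.gr a g)
    (hη : η ∈ W.gr b h) :
    tmul ξ η ∈ (V.tensor W).gr (R.dot a b) ((R.tau a b)⁻¹ * g * h) := by
  change ξ ⊗ₜ[k] η ∈ tensorGr V W _ _
  exact Submodule.mem_iSup_of_mem (a, g) <| Submodule.mem_iSup_of_mem (b, h) <|
    Submodule.mem_iSup_of_mem rfl <| Submodule.apply_mem_map₂ _ hξ hη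

theorem tensor_gr_le {c : R.M} {v : G} {S : Submodule k (V.tensor W)}
    (hS : ∀ a g b h, R.dot a b = c → (R.tau a b)⁻¹ * g * h = v →
      ∀ ξ ∈ V.gr a g, ∀ η ∈ W.gr b h, tmul ξ η ∈ S) :
    (V.tensor W).gr c v ≤ S :=
  iSup_le fun i => iSup_le fun j => iSup_le fun hij => Submodule.map₂_le.2 fun ξ hξ η hη =>
    hS i.1 i.2 j.1 j.2 (congrArg Prod.fst hij) (congrArg Prod.snd hij) ξ hξ η hη

theorem tensor_act_tmul (u : G) (ξ : V) {b : R.M} {h : G} {η : W} (hη : η ∈ W.gr b h) :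
    (V.tensor W).act u (tmul ξ η) = tmul (V.act (R.la b u) ξ) (W.act u η) := by
  change V.tensorAct W u (ξ ⊗ₜ η) = V.act (R.la b u) ξ ⊗ₜ W.act u η
  rw [tensorAct, LinearMap.sum_apply, Finset.sum_eq_single b]
  · rw [TensorProduct.map_tmul, LinearMap.comp_apply, W.mproj_of_mem hη]
  · intro c _ hc
    rw [TensorProduct.map_tmul, LinearMap.comp_apply, W.mproj_of_mem_of_ne hη hc, map_zero,
      tmul_zero]
  · simp

theorem tensor_mact_tmul (s : R.M) {a b c : R.M} {g h h' : G} {ξ : V} {η : W}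
    (hξ : ξ ∈ V.gr a g) (hη : η ∈ W.gr b h) (hc : W.mact (R.ra s g) η ∈ W.gr c h') :
    (V.tensor W).mact (R.ra s (R.tau a b)) (tmul ξ η) =
      tmul (V.act (R.tau (R.ra s g) b * (R.tau c (R.ra s (g * h)))⁻¹) (V.mact s ξ))
        (W.mact (R.ra s g) η) := by
  classical
  change V.tensorMact W (R.ra s (R.tau a b)) (ξ ⊗ₜ η) =
    V.act (R.tau (R.ra s g) b * (R.tau c (R.ra s (g * h)))⁻¹) (V.mact s ξ) ⊗ₜ
      W.mact (R.ra s g) η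
  rw [tensorMact, LinearMap.sum_apply, Finset.sum_eq_single (a, g), LinearMap.sum_apply,
    Finset.sum_eq_single (b, h), LinearMap.sum_apply, Finset.sum_eq_single c]
  · simp only [← R.ra_mul, mul_inv_cancel, R.ra_one, TensorProduct.map_tmul,
      LinearMap.comp_apply, V.proj_of_mem _ (a, g) ξ hξ, W.proj_of_mem _ (b, h) η hη, if_true,
      W.mproj_of_mem hc]
  · intro d _ hd
    simp only [← R.ra_mul, mul_inv_cancel, R.ra_one, TensorProduct.map_tmul,
      LinearMap.comp_apply, W.proj_of_mem _ (b, h) η hη, if_true,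
      W.mproj_of_mem_of_ne hc hd, tmul_zero]
  · simp
  · intro j _ hj
    simp [LinearMap.sum_apply, W.proj_of_mem _ (b, h) η hη, hj]
  · simp
  · intro i _ hi
    simp [LinearMap.sum_apply, V.proj_of_mem _ (a, g) ξ hξ, hi]
  · simp

section Twist

variable {ρ : Representation k X V} {σ : Representation k X W}

/-- The isomorphism `ξ ⊗ η ↦ ρ(|η|) ξ ⊗ η`, under which the structure of `V.tensor W` corresponds
to the usual tensor product of crossed modules. -/
noncomputable def twist (ρ : Representation k X V) (W : Data k R) :
    V ⊗[k] W ≃ₗ[k] V.tensor W :=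
  TensorProduct.comm k V W ≪≫ₗ W.gradedAct ρ (fun _ h => h) ≪≫ₗ TensorProduct.comm k W V ≪≫ₗ
    tensorEquiv V W

theorem twist_tmul (ξ : V) {b : R.M} {h : G} {η : W} (hη : η ∈ W.gr b h) :
    twist ρ W (ξ ⊗ₜ η) = tmul (ρ h ξ) η := by
  rw [twist, LinearEquiv.trans_apply, LinearEquiv.trans_apply, LinearEquiv.trans_apply,
    TensorProduct.comm_tmul, gradedAct_tmul _ _ hη, TensorProduct.comm_tmul, tensorEquiv_tmul]

theorem tmul_eq_twist (ξ : V) {b : R.M} {h : G} {η : W} (hη : η ∈ W.gr b h) :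
    tmul ξ η = twist ρ W (ρ (h : X)⁻¹ ξ ⊗ₜ η) := by
  rw [twist_tmul _ hη, ρ.self_inv_apply]

/-- The action `ρ ⊗ σ` of `X`, transported to `V.tensor W` along `twist`. -/
noncomputable def tensorRho (ρ : Representation k X V) (σ : Representation k X W) :
    Representation k X (V.tensor W) :=
  ((twist ρ W).conjRingEquiv : _ →* _).comp (ρ.tprod σ)

theorem tensorRho_twist (y : X) (ξ : V) (η : W) :
    tensorRho ρ σ y (twist ρ W (ξ ⊗ₜ η)) = twist ρ W (ρ y ξ ⊗ₜ σ y η) := by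
  change twist ρ W (ρ.tprod σ y ((twist ρ W).symm (twist ρ W (ξ ⊗ₜ η)))) = _
  rw [LinearEquiv.symm_apply_apply, Representation.tprod_apply, TensorProduct.map_tmul]

theorem tensorRho_tmul (y : X) (ξ : V) {b b' : R.M} {h h' : G} {η : W} (hη : η ∈ W.gr b h)
    (hη' : σ y η ∈ W.gr b' h') :
    tensorRho ρ σ y (tmul ξ η) = tmul (ρ (h' * y * (h : X)⁻¹) ξ) (σ y η) := by
  rw [tmul_eq_twist ξ hη, tensorRho_twist, twist_tmul _ hη', map_mul, map_mul,
    Module.End.mul_apply, Module.End.mul_apply]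

end Twist

namespace IsCrossed

variable {ρ : Representation k X V} {σ : Representation k X W}

theorem twist_mem_homog (hρ : V.IsCrossed ρ) {x y : X} {ξ : V} {η : W} (hξ : ξ ∈ V.homog x)
    (hη : η ∈ W.homog y) : twist ρ W (ξ ⊗ₜ η) ∈ (V.tensor W).homog (x * y) := by
  have hmem := tmul_mem_gr (hρ.mem ((R.groupPart y)⁻¹ : G) x ξ hξ) hη
  rw [gr_eq_homog, R.tensor_degree] at hmem
  rw [twist_tmul ξ hη]
  convert hmem using 2
  conv_lhs => rw [← R.groupPart_mul_repPart y]
  simp only [Subgroup.coe_inv, inv_inv, R.groupPart_mul_repPart, mul_assoc, mul_inv_cancel_left]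

theorem tensor_homog_le (hρ : V.IsCrossed ρ) {d : X} {S : Submodule k (V.tensor W)}
    (hS : ∀ x y, x * y = d → ∀ ξ ∈ V.homog x, ∀ η ∈ W.homog y, twist ρ W (ξ ⊗ₜ η) ∈ S) :
    (V.tensor W).homog d ≤ S := by
  refine tensor_gr_le fun a g b h hdot htau ξ hξ η hη => ?_
  have hd := R.tensor_degree a b g h
  rw [hdot, htau, Subgroup.coe_inv, inv_inv, R.groupPart_mul_repPart] at hd
  rw [tmul_eq_twist ξ hη]
  refine hS _ _ ?_ _ (hρ.mem _ _ ξ (mem_homog_of_mem_gr hξ)) η (mem_homog_of_mem_gr hη)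
  simp only [hd, inv_inv, mul_assoc, mul_inv_cancel_left]

theorem tensor_act_eq (hρ : V.IsCrossed ρ) (hσ : W.IsCrossed σ) (u : G) :
    (V.tensor W).act u = tensorRho ρ σ (u : X)⁻¹ := by
  refine TensorProduct.ext (M := V) (N := W) <|
    LinearMap.ext fun ξ => linearMap_ext_homog fun y η hη => ?_
  change (V.tensor W).act u (tmul ξ η) = tensorRho ρ σ (u : X)⁻¹ (tmul ξ η)
  have hη' := hσ.act_mem_gr u hη
  rw [hσ.act_eq] at hη'
  rw [tensor_act_tmul u ξ hη, tensorRho_tmul _ ξ hη hη', hρ.act_eq, hσ.act_eq]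
  congr 4
  simp

theorem tensor_mact_eq (hρ : V.IsCrossed ρ) (hσ : W.IsCrossed σ) (s : R.M) {a b : R.M} {g h : G}
    {ξ : V} {η : W} (hξ : ξ ∈ V.gr a g) (hη : η ∈ W.gr b h) :
    (V.tensor W).mact (R.ra s (R.tau a b)) (tmul ξ η) =
      tensorRho ρ σ (R.ra s (g * h)) (tmul ξ η) := by
  obtain ⟨c, h', hη', -, htau⟩ := hσ.isObject.mact_mem (R.ra s g) b h η hη
  rw [tensor_mact_tmul s hξ hη hη', hρ.mact_eq s a g ξ hξ, hρ.act_eq]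
  rw [hσ.mact_eq _ b h η hη] at hη' ⊢
  rw [R.ra_mul, tensorRho_tmul _ ξ hη hη', ← Module.End.mul_apply, ← map_mul]
  congr 4
  have hh' : h' = R.tau c (R.ra (R.ra s g) h) * ((R.tau (R.ra s g) b)⁻¹ * R.la (R.ra s g) h) :=
    eq_mul_of_inv_mul_eq htau.symm
  simp only [hh', Subgroup.coe_mul, Subgroup.coe_inv, mul_inv_rev, inv_inv, mul_assoc]
  rw [← mul_assoc (R.la (R.ra s g) h : X), R.la_mul_ra, mul_inv_cancel_right]

theorem tensor (hρ : V.IsCrossed ρ) (hσ : W.IsCrossed σ) :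
    (V.tensor W).IsCrossed (tensorRho ρ σ) where
  act_eq u := LinearMap.congr_fun (hρ.tensor_act_eq hσ u)
  mact_eq t c v := by
    suffices (V.tensor W).gr c v ≤
      LinearMap.eqLocus ((V.tensor W).mact t) (tensorRho ρ σ (R.ra t v)) from this
    refine tensor_gr_le fun a g b h _ htau ξ hξ η hη => ?_
    have hmact := hρ.tensor_mact_eq hσ (R.ra t (R.tau a b)⁻¹) hξ hη
    rwa [R.ra_inv_ra, ← R.ra_mul, ← mul_assoc, htau] at hmact
  mem z d := by
    suffices (V.tensor W).homog d ≤
      Submodule.comap (tensorRho ρ σ z) ((V.tensor W).homog (z * d * z⁻¹)) from this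
    refine hρ.tensor_homog_le fun x y hxy ξ hξ η hη => ?_
    rw [Submodule.mem_comap, tensorRho_twist]
    convert hρ.twist_mem_homog (hρ.mem z x ξ hξ) (hσ.mem z y η hη) using 2
    rw [← hxy]
    group

end IsCrossed

theorem unit_isCrossed : (Data.unit k R).IsCrossed 1 where
  act_eq _ _ := rfl
  mact_eq _ _ _ _ _ := rfl
  mem y x ξ hξ := by
    by_cases hx : R.repPart x = R.e ∧ (R.groupPart x)⁻¹ = 1
    · have hx1 : x = 1 := by
        rw [← R.groupPart_mul_repPart x, hx.1, inv_eq_one.1 hx.2, R.coe_e, Subgroup.coe_one,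
          mul_one]
      rwa [hx1, mul_one, mul_inv_cancel, ← hx1]
    · have hξ0 : ξ = 0 := by
        simp only [homog, unit, if_neg hx] at hξ
        exact hξ
      rw [hξ0, map_zero]
      exact zero_mem _

end Data

end Tensor

namespace D

open Data

variable {X : Type w} [Group X] {G : Subgroup X} {k : Type u} [Field k] {R : LeftCosetReps G}

section Morphisms

variable {V W : D k R}

theorem hom_ext {f g : V ⟶ W} (h : linear f = linear g) : f = g := Hom.ext h

theorem linear_comp {U V W : D k R} (f : U ⟶ V) (g : V ⟶ W) (ξ : U) :
    linear (f ≫ g) ξ = linear g (linear f ξ) := rfl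

theorem linear_id (V : D k R) (ξ : V) : linear (𝟙 V) ξ = ξ := rfl

theorem linear_mem_homog (f : V ⟶ W) {x : X} {ξ : V} (hξ : ξ ∈ V.data.homog x) :
    linear f ξ ∈ W.data.homog x :=
  Hom.map_gr f _ _ ξ hξ

variable [Finite X]

/-- The representation of `X` which makes an object of `𝒟` a crossed `X`-module. -/
noncomputable def rho (V : D k R) : Representation k X V := V.isObject.rho

theorem isCrossed (V : D k R) : V.data.IsCrossed V.rho := V.isObject.isCrossed

theorem rho_mem_homog (V : D k R) (y : X) {x : X} {ξ : V} (hξ : ξ ∈ V.data.homog x) :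
    V.rho y ξ ∈ V.data.homog (y * x * y⁻¹) :=
  V.isCrossed.mem y x ξ hξ

theorem linear_rho (f : V ⟶ W) (y : X) (ξ : V) :
    linear f (V.rho y ξ) = W.rho y (linear f ξ) := by
  have on_group (u : G) (ξ : V) : linear f (V.rho u ξ) = W.rho u (linear f ξ) := by
    rw [← inv_inv (u : X), ← Subgroup.coe_inv, ← V.isCrossed.act_eq, ← W.isCrossed.act_eq]
    exact Hom.map_act f u⁻¹ ξ
  have on_reps (s : R.M) : linear f ∘ₗ V.rho s = W.rho s ∘ₗ linear f :=
    linearMap_ext_homog fun x ξ hξ => by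
      rw [LinearMap.comp_apply, LinearMap.comp_apply, ← R.ra_inv_ra s (R.groupPart x)⁻¹,
        ← V.isCrossed.mact_eq _ _ _ ξ hξ, ← W.isCrossed.mact_eq _ _ _ _ (linear_mem_homog f hξ)]
      exact Hom.map_mact f _ ξ
  rw [← R.groupPart_mul_repPart y, map_mul, map_mul, Module.End.mul_apply, Module.End.mul_apply,
    on_group]
  exact congrArg _ (LinearMap.congr_fun (on_reps _) ξ)

/-- The morphism given by a linear map that is homogeneous for the `X`-grading and commutes with
the action of `X`. -/
noncomputable def homOf (f : V →ₗ[k] W) (hgr : ∀ x, ∀ ξ ∈ V.data.homog x, f ξ ∈ W.data.homog x)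
    (hrho : ∀ y, f ∘ₗ V.rho y = W.rho y ∘ₗ f) : V ⟶ W :=
  have map_gr (s : R.M) (u : G) : ∀ ξ ∈ V.data.gr s u, f ξ ∈ W.data.gr s u := by
    rw [gr_eq_homog, gr_eq_homog]
    exact hgr _
  Hom.mk f map_gr
    (fun u ξ => by
      rw [V.isCrossed.act_eq, W.isCrossed.act_eq]
      exact LinearMap.congr_fun (hrho _) ξ)
    (fun t ξ => by
      induction ξ using homog_induction with
      | add ξ η hξ hη => simp only [map_add, hξ, hη]
      | homog x ξ hξ =>
        rw [V.isCrossed.mact_eq t _ _ ξ hξ, W.isCrossed.mact_eq t _ _ _ (hgr x ξ hξ)]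
        exact LinearMap.congr_fun (hrho _) ξ)

theorem symm_mem_homog (f : V ≃ₗ[k] W) (hgr : ∀ x, ∀ ξ ∈ V.data.homog x, f ξ ∈ W.data.homog x)
    (x : X) (η : W) (hη : η ∈ W.data.homog x) : f.symm η ∈ V.data.homog x := by
  classical
  set i := (R.repPart x, (R.groupPart x)⁻¹)
  have hproj : f.toLinearMap ∘ₗ V.data.proj i = W.data.proj i ∘ₗ f.toLinearMap :=
    linearMap_ext_homog fun y ξ hξ => by
      simp only [LinearMap.comp_apply, LinearEquiv.coe_coe]
      rw [V.data.proj_of_mem i (R.repPart y, (R.groupPart y)⁻¹) ξ hξ,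
        W.data.proj_of_mem i (R.repPart y, (R.groupPart y)⁻¹) _ (hgr y ξ hξ), apply_ite f, map_zero]
  have hη' := LinearMap.congr_fun hproj (f.symm η)
  simp only [LinearMap.comp_apply, LinearEquiv.coe_coe, LinearEquiv.apply_symm_apply] at hη'
  rw [W.data.proj_of_mem i i η hη, if_pos rfl, ← LinearEquiv.eq_symm_apply] at hη'
  exact hη' ▸ V.data.proj_mem i _

/-- The isomorphism given by a linear equivalence that is homogeneous for the `X`-grading and
commutes with the action of `X`. -/
noncomputable def isoOf (f : V ≃ₗ[k] W)
    (hgr : ∀ x, ∀ ξ ∈ V.data.homog x, f ξ ∈ W.data.homog x)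
    (hrho : ∀ y, f.toLinearMap ∘ₗ V.rho y = W.rho y ∘ₗ f.toLinearMap) : V ≅ W where
  hom := homOf f.toLinearMap hgr hrho
  inv := homOf f.symm.toLinearMap (symm_mem_homog f hgr) fun y => LinearMap.ext fun η => by
    have hy := LinearMap.congr_fun (hrho y) (f.symm η)
    simp only [LinearMap.comp_apply, LinearEquiv.coe_coe, LinearEquiv.apply_symm_apply] at hy ⊢
    rw [← hy, LinearEquiv.symm_apply_apply]
  hom_inv_id := hom_ext (LinearMap.ext f.symm_apply_apply)
  inv_hom_id := hom_ext (LinearMap.ext f.apply_symm_apply)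

end Morphisms

section Tensor

variable [Finite X]

/-- The tensor product of objects of `𝒟`. -/
noncomputable def tensor (V W : D k R) : D k R :=
  ⟨V.data.tensor W.data, (V.isCrossed.tensor W.isCrossed).isObject⟩

/-- The unit object of `𝒟`. -/
noncomputable def unit (k : Type u) [Field k] (R : LeftCosetReps G) : D k R :=
  ⟨Data.unit k R, unit_isCrossed.isObject⟩

theorem rho_unit : (unit k R).rho = 1 := (unit k R).isCrossed.eq unit_isCrossed

variable {V W : D k R}

/-- The isomorphism `ξ ⊗ η ↦ ρ(|η|) ξ ⊗ η`, with values in an object of `𝒟`. -/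
noncomputable def crossEquiv (V W : D k R) : V ⊗[k] W ≃ₗ[k] V.tensor W := twist V.rho W.data

/-- The element `ρ(|η|) ξ ⊗ η` of `V ⊗ W`, written `ξ ⊠ η`. In terms of these elements the grading
by `X`, the action of `X` and the structure maps take their standard form. -/
noncomputable def crossTmul : V →ₗ[k] W →ₗ[k] V.tensor W :=
  TensorProduct.curry (crossEquiv V W).toLinearMap

local infixr:70 " ⊠ " => crossTmul

theorem crossEquiv_tmul (ξ : V) (η : W) : crossEquiv V W (ξ ⊗ₜ η) = ξ ⊠ η := rfl

theorem crossEquiv_symm_crossTmul (ξ : V) (η : W) : (crossEquiv V W).symm (ξ ⊠ η) = ξ ⊗ₜ η :=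
  (crossEquiv V W).symm_apply_apply _

theorem crossTmul_eq_tmul (ξ : V) {b : R.M} {h : G} {η : W} (hη : η ∈ W.data.gr b h) :
    ξ ⊠ η = tmul (V.rho h ξ) η :=
  twist_tmul ξ hη

theorem tmul_eq_crossTmul (ξ : V) {b : R.M} {h : G} {η : W} (hη : η ∈ W.data.gr b h) :
    tmul ξ η = V.rho (h : X)⁻¹ ξ ⊠ η :=
  tmul_eq_twist ξ hη

theorem crossTmul_mem_homog {x y : X} {ξ : V} {η : W} (hξ : ξ ∈ V.data.homog x)
    (hη : η ∈ W.data.homog y) : ξ ⊠ η ∈ (V.tensor W).data.homog (x * y) :=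
  V.isCrossed.twist_mem_homog hξ hη

theorem tensor_homog_le {d : X} {S : Submodule k (V.tensor W)}
    (hS : ∀ x y, x * y = d → ∀ ξ ∈ V.data.homog x, ∀ η ∈ W.data.homog y, ξ ⊠ η ∈ S) :
    (V.tensor W).data.homog d ≤ S :=
  V.isCrossed.tensor_homog_le hS

theorem rho_crossTmul (y : X) (ξ : V) (η : W) :
    (V.tensor W).rho y (ξ ⊠ η) = V.rho y ξ ⊠ W.rho y η := by
  rw [(V.tensor W).isCrossed.eq (V.isCrossed.tensor W.isCrossed)]
  exact tensorRho_twist y ξ η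

section Ext

variable {U T : D k R} {Z : Type*} [AddCommGroup Z] [Module k Z]

theorem tensor_ext {f g : V.tensor W →ₗ[k] Z}
    (h : ∀ x, ∀ ξ ∈ V.data.homog x, ∀ y, ∀ η ∈ W.data.homog y, f (ξ ⊠ η) = g (ξ ⊠ η)) :
    f = g := by
  have hcross : f ∘ₗ (crossEquiv V W).toLinearMap = g ∘ₗ (crossEquiv V W).toLinearMap :=
    TensorProduct.ext <| linearMap_ext_homog fun x ξ hξ => linearMap_ext_homog (h x ξ hξ)
  exact (LinearMap.cancel_right (crossEquiv V W).surjective).1 hcross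

theorem tensor_ext_left {f g : (U.tensor V).tensor W →ₗ[k] Z}
    (h : ∀ x, ∀ ξ ∈ U.data.homog x, ∀ y, ∀ η ∈ V.data.homog y, ∀ z, ∀ ζ ∈ W.data.homog z,
      f ((ξ ⊠ η) ⊠ ζ) = g ((ξ ⊠ η) ⊠ ζ)) : f = g :=
  tensor_ext fun _ ω _ z ζ hζ => LinearMap.congr_fun
    (f := f ∘ₗ crossTmul.flip ζ) (g := g ∘ₗ crossTmul.flip ζ)
    (tensor_ext fun x ξ hξ y η hη => h x ξ hξ y η hη z ζ hζ) ω

theorem tensor_ext_right {f g : U.tensor (V.tensor W) →ₗ[k] Z}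
    (h : ∀ x, ∀ ξ ∈ U.data.homog x, ∀ y, ∀ η ∈ V.data.homog y, ∀ z, ∀ ζ ∈ W.data.homog z,
      f (ξ ⊠ η ⊠ ζ) = g (ξ ⊠ η ⊠ ζ)) : f = g :=
  tensor_ext fun x ξ hξ _ ω _ => LinearMap.congr_fun
    (f := f ∘ₗ crossTmul ξ) (g := g ∘ₗ crossTmul ξ) (tensor_ext (h x ξ hξ)) ω

theorem tensor_ext_left_left {f g : ((U.tensor V).tensor W).tensor T →ₗ[k] Z}
    (h : ∀ (ξ : U) (η : V) (ζ : W) (ω : T), f (((ξ ⊠ η) ⊠ ζ) ⊠ ω) = g (((ξ ⊠ η) ⊠ ζ) ⊠ ω)) :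
    f = g :=
  tensor_ext fun _ ϑ _ _ ω _ => LinearMap.congr_fun
    (f := f ∘ₗ crossTmul.flip ω) (g := g ∘ₗ crossTmul.flip ω)
    (tensor_ext_left fun _ ξ _ _ η _ _ ζ _ => h ξ η ζ ω) ϑ

end Ext

section TensorHom

variable {V' W' V'' W'' : D k R}

/-- The linear map `ξ ⊗ η ↦ θ(ξ) ⊗ φ(η)`. -/
noncomputable def tensorMap (θ : V ⟶ V') (φ : W ⟶ W') : V.tensor W →ₗ[k] V'.tensor W' :=
  TensorProduct.map (linear θ) (linear φ)

theorem tensorMap_crossTmul (θ : V ⟶ V') (φ : W ⟶ W') (ξ : V) (η : W) :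
    tensorMap θ φ (ξ ⊠ η) = linear θ ξ ⊠ linear φ η := by
  induction η using homog_induction with
  | add η η' hη hη' => simp only [map_add, hη, hη']
  | homog y η hη =>
    rw [crossTmul_eq_tmul ξ hη, crossTmul_eq_tmul _ (linear_mem_homog φ hη), ← linear_rho]
    rfl

/-- The tensor product of morphisms of `𝒟`. -/
noncomputable def tensorHom (θ : V ⟶ V') (φ : W ⟶ W') : V.tensor W ⟶ V'.tensor W' :=
  homOf (tensorMap θ φ)
    (fun d => by
      suffices (V.tensor W).data.homog d ≤
        ((V'.tensor W').data.homog d).comap (tensorMap θ φ) from this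
      refine tensor_homog_le fun x y hxy ξ hξ η hη => ?_
      rw [Submodule.mem_comap, tensorMap_crossTmul, ← hxy]
      exact crossTmul_mem_homog (linear_mem_homog θ hξ) (linear_mem_homog φ hη))
    (fun y => tensor_ext fun _ ξ _ _ η _ => by
      simp only [LinearMap.comp_apply, rho_crossTmul, tensorMap_crossTmul, linear_rho])

theorem tensorHom_crossTmul (θ : V ⟶ V') (φ : W ⟶ W') (ξ : V) (η : W) :
    linear (tensorHom θ φ) (ξ ⊠ η) = linear θ ξ ⊠ linear φ η :=
  tensorMap_crossTmul θ φ ξ η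

theorem tensorHom_id_id (V W : D k R) : tensorHom (𝟙 V) (𝟙 W) = 𝟙 (V.tensor W) :=
  hom_ext (tensor_ext fun _ _ _ _ _ _ => tensorHom_crossTmul _ _ _ _)

theorem tensorHom_comp (θ : V ⟶ V') (φ : W ⟶ W') (θ' : V' ⟶ V'') (φ' : W' ⟶ W'') :
    tensorHom θ φ ≫ tensorHom θ' φ' = tensorHom (θ ≫ θ') (φ ≫ φ') :=
  hom_ext (tensor_ext fun _ _ _ _ _ _ => by simp only [linear_comp, tensorHom_crossTmul])

end TensorHom

section Associator

/-- The linear equivalence `(ξ ⊠ η) ⊠ ζ ↦ ξ ⊠ (η ⊠ ζ)`. -/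
noncomputable def assocEquiv (U V W : D k R) :
    (U.tensor V).tensor W ≃ₗ[k] U.tensor (V.tensor W) :=
  (crossEquiv (U.tensor V) W).symm ≪≫ₗ (crossEquiv U V).symm.rTensor W ≪≫ₗ
    TensorProduct.assoc k U V W ≪≫ₗ (crossEquiv V W).lTensor U ≪≫ₗ crossEquiv U (V.tensor W)

variable {U V W : D k R}

theorem assocEquiv_crossTmul (ξ : U) (η : V) (ζ : W) :
    assocEquiv U V W ((ξ ⊠ η) ⊠ ζ) = ξ ⊠ η ⊠ ζ := by
  simp only [assocEquiv, LinearEquiv.trans_apply, crossEquiv_symm_crossTmul,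
    LinearEquiv.rTensor_tmul, TensorProduct.assoc_tmul, LinearEquiv.lTensor_tmul, crossEquiv_tmul]

/-- The associator `Φ` of `𝒟`. -/
noncomputable def associator (U V W : D k R) : (U.tensor V).tensor W ≅ U.tensor (V.tensor W) :=
  isoOf (assocEquiv U V W)
    (fun d => by
      suffices ((U.tensor V).tensor W).data.homog d ≤
        ((U.tensor (V.tensor W)).data.homog d).comap (assocEquiv U V W).toLinearMap from this
      refine tensor_homog_le fun v z hvz ω hω ζ hζ => ?_
      suffices (U.tensor V).data.homog v ≤ (((U.tensor (V.tensor W)).data.homog d).comap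
        (assocEquiv U V W).toLinearMap).comap (crossTmul.flip ζ) from this hω
      refine tensor_homog_le fun x y hxy ξ hξ η hη => ?_
      rw [Submodule.mem_comap, Submodule.mem_comap, LinearMap.flip_apply, LinearEquiv.coe_coe,
        assocEquiv_crossTmul, ← hvz, ← hxy, mul_assoc]
      exact crossTmul_mem_homog hξ (crossTmul_mem_homog hη hζ))
    (fun y => tensor_ext_left fun _ ξ _ _ η _ _ ζ _ => by
      simp only [LinearMap.comp_apply, LinearEquiv.coe_coe, rho_crossTmul, assocEquiv_crossTmul])

theorem associator_hom_crossTmul (ξ : U) (η : V) (ζ : W) :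
    linear (associator U V W).hom ((ξ ⊠ η) ⊠ ζ) = ξ ⊠ η ⊠ ζ :=
  assocEquiv_crossTmul ξ η ζ

theorem associator_inv_crossTmul (ξ : U) (η : V) (ζ : W) :
    linear (associator U V W).inv (ξ ⊠ η ⊠ ζ) = (ξ ⊠ η) ⊠ ζ := by
  rw [← associator_hom_crossTmul, ← linear_comp, Iso.hom_inv_id, linear_id]

theorem associator_hom_tmul (ξ : U) {b c : R.M} {h h' : G} {η : V} {ζ : W}
    (hη : η ∈ V.data.gr b h) (hζ : ζ ∈ W.data.gr c h') :
    linear (associator U V W).hom (tmul (tmul ξ η) ζ) =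
      tmul (U.data.act (R.tau b c) ξ) (tmul η ζ) := by
  have hηζ := tmul_mem_gr (V := V.data) (W := W.data) hη hζ
  have hcross : (tmul (tmul ξ η) ζ : (U.tensor V).tensor W) =
      (U.rho (h' : X)⁻¹ (U.rho (h : X)⁻¹ ξ) ⊠ V.rho (h' : X)⁻¹ η) ⊠ ζ := by
    rw [← rho_crossTmul, ← tmul_eq_crossTmul ξ hη]
    exact tmul_eq_crossTmul (V := U.tensor V) _ hζ
  rw [hcross, associator_hom_crossTmul, ← tmul_eq_crossTmul η hζ,
    crossTmul_eq_tmul (V := U) (W := V.tensor W) _ hηζ, U.isCrossed.act_eq]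
  simp only [← Module.End.mul_apply, ← map_mul, Subgroup.coe_mul, Subgroup.coe_inv, mul_assoc,
    mul_inv_cancel_left, mul_inv_cancel, mul_one]
  rfl

end Associator

section Braiding

/-- The linear equivalence `ξ ⊠ η ↦ ρ(‖ξ‖) η ⊠ ξ`. -/
noncomputable def braidEquiv (V W : D k R) : V.tensor W ≃ₗ[k] W.tensor V :=
  (crossEquiv V W).symm ≪≫ₗ V.data.gradedAct W.rho (fun a g => (g : X)⁻¹ * a) ≪≫ₗ
    TensorProduct.comm k V W ≪≫ₗ crossEquiv W V

variable {V W : D k R}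

theorem braidEquiv_crossTmul {x : X} {ξ : V} (hξ : ξ ∈ V.data.homog x) (η : W) :
    braidEquiv V W (ξ ⊠ η) = W.rho x η ⊠ ξ := by
  simp only [braidEquiv, LinearEquiv.trans_apply, crossEquiv_symm_crossTmul,
    gradedAct_tmul _ _ hξ, TensorProduct.comm_tmul, crossEquiv_tmul, Subgroup.coe_inv, inv_inv,
    R.groupPart_mul_repPart]

/-- The braiding `Ψ` of `𝒟`. -/
noncomputable def braiding (V W : D k R) : V.tensor W ≅ W.tensor V :=
  isoOf (braidEquiv V W)
    (fun d => by
      suffices (V.tensor W).data.homog d ≤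
        ((W.tensor V).data.homog d).comap (braidEquiv V W).toLinearMap from this
      refine tensor_homog_le fun x y hxy ξ hξ η hη => ?_
      rw [Submodule.mem_comap, LinearEquiv.coe_coe, braidEquiv_crossTmul hξ, ← hxy,
        ← inv_mul_cancel_right (x * y) x]
      exact crossTmul_mem_homog (W.rho_mem_homog x hη) hξ)
    (fun y => tensor_ext fun x ξ hξ _ η _ => by
      rw [LinearMap.comp_apply, LinearMap.comp_apply, LinearEquiv.coe_coe, rho_crossTmul,
        braidEquiv_crossTmul hξ, braidEquiv_crossTmul (V.rho_mem_homog y hξ), rho_crossTmul]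
      simp only [← Module.End.mul_apply, ← map_mul, inv_mul_cancel_right])

theorem braiding_hom_crossTmul {x : X} {ξ : V} (hξ : ξ ∈ V.data.homog x) (η : W) :
    linear (braiding V W).hom (ξ ⊠ η) = W.rho x η ⊠ ξ :=
  braidEquiv_crossTmul hξ η

theorem braiding_hom_tmul {a b : R.M} {g h : G} {ξ : V} {η : W} (hξ : ξ ∈ V.data.gr a g)
    (hη : η ∈ W.data.gr b h) :
    linear (braiding V W).hom (tmul ξ η) = tmul (W.data.mact a η) (V.data.act h ξ) := by
  have hact := V.isCrossed.act_mem_gr h hξ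
  have hhomog := mem_homog_of_mem_gr hact
  rw [tmul_eq_crossTmul ξ hη, ← V.isCrossed.act_eq, braiding_hom_crossTmul hhomog,
    crossTmul_eq_tmul _ hact, W.isCrossed.mact_eq a b h η hη, ← Module.End.mul_apply, ← map_mul,
    mul_inv_cancel_left]

end Braiding

section Units

/-- The element `1` of the unit object. -/
def one (k : Type u) [Field k] (R : LeftCosetReps G) : unit k R := (1 : k)

theorem one_mem_gr : one k R ∈ (unit k R).data.gr R.e 1 := by
  have hgr : (unit k R).data.gr R.e 1 = ⊤ := if_pos ⟨rfl, rfl⟩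
  rw [hgr]
  trivial

theorem one_mem_homog : one k R ∈ (unit k R).data.homog 1 := by
  have h := mem_homog_of_mem_gr (one_mem_gr (k := k) (R := R))
  rwa [Subgroup.coe_one, R.coe_e, inv_one, one_mul] at h

theorem eq_smul_one (c : unit k R) : ∃ r : k, c = r • one k R :=
  ⟨c, (mul_one (M := k) c).symm⟩

variable {V W : D k R}

theorem crossTmul_one (ξ : V) : ξ ⊠ one k R = tmul ξ (one k R) := by
  rw [crossTmul_eq_tmul ξ one_mem_gr, Subgroup.coe_one, map_one, Module.End.one_apply]

theorem one_crossTmul (ξ : V) : one k R ⊠ ξ = tmul (one k R) ξ := by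
  induction ξ using homog_induction with
  | add ξ η hξ hη =>
    rw [map_add, hξ, hη]
    exact (map_add (tmul (one k R)) ξ η).symm
  | homog x ξ hξ => rw [crossTmul_eq_tmul _ hξ, rho_unit, MonoidHom.one_apply, Module.End.one_apply]

/-- The isomorphism `l : V ≅ V ⊗ k`, `ξ ↦ ξ ⊗ 1`. -/
noncomputable def rightUnit (V : D k R) : V ≅ V.tensor (unit k R) :=
  isoOf (W := V.tensor (unit k R)) (TensorProduct.rid k V).symm
    (fun x ξ hξ => by
      have hmem := crossTmul_mem_homog hξ one_mem_homog
      rwa [mul_one, crossTmul_one] at hmem)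
    (fun y => LinearMap.ext fun ξ => by
      have hrho := rho_crossTmul y ξ (one k R)
      rw [rho_unit, MonoidHom.one_apply, Module.End.one_apply, crossTmul_one, crossTmul_one] at hrho
      exact hrho.symm)

/-- The isomorphism `r : V ≅ k ⊗ V`, `ξ ↦ 1 ⊗ ξ`. -/
noncomputable def leftUnit (V : D k R) : V ≅ (unit k R).tensor V :=
  isoOf (W := (unit k R).tensor V) (TensorProduct.lid k V).symm
    (fun x ξ hξ => by
      have hmem := crossTmul_mem_homog one_mem_homog hξ
      rwa [one_mul, one_crossTmul] at hmem)
    (fun y => LinearMap.ext fun ξ => by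
      have hrho := rho_crossTmul y (one k R) ξ
      rw [rho_unit, MonoidHom.one_apply, Module.End.one_apply, one_crossTmul, one_crossTmul] at hrho
      exact hrho.symm)

theorem rightUnit_hom_apply (ξ : V) : linear (rightUnit V).hom ξ = ξ ⊠ one k R :=
  (crossTmul_one ξ).symm

theorem leftUnit_hom_apply (ξ : V) : linear (leftUnit V).hom ξ = one k R ⊠ ξ :=
  (one_crossTmul ξ).symm

theorem rightUnit_inv_crossTmul (ξ : V) : linear (rightUnit V).inv (ξ ⊠ one k R) = ξ := by
  rw [← rightUnit_hom_apply, ← linear_comp, Iso.hom_inv_id, linear_id]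

theorem leftUnit_inv_crossTmul (ξ : V) : linear (leftUnit V).inv (one k R ⊠ ξ) = ξ := by
  rw [← leftUnit_hom_apply, ← linear_comp, Iso.hom_inv_id, linear_id]

end Units

section Coherence

variable {U V W U' V' W' : D k R}

theorem associator_naturality (f : U ⟶ U') (g : V ⟶ V') (h : W ⟶ W') :
    tensorHom (tensorHom f g) h ≫ (associator U' V' W').hom =
      (associator U V W).hom ≫ tensorHom f (tensorHom g h) :=
  hom_ext <| tensor_ext_left fun _ _ _ _ _ _ _ _ _ => by
    simp only [linear_comp, tensorHom_crossTmul, associator_hom_crossTmul]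

theorem leftUnit_naturality (f : V ⟶ W) :
    tensorHom (𝟙 (unit k R)) f ≫ (leftUnit W).inv = (leftUnit V).inv ≫ f := by
  rw [Iso.comp_inv_eq, Category.assoc, Iso.eq_inv_comp]
  exact hom_ext <| LinearMap.ext fun ξ => by
    simp only [linear_comp, leftUnit_hom_apply, tensorHom_crossTmul, linear_id]

theorem rightUnit_naturality (f : V ⟶ W) :
    tensorHom f (𝟙 (unit k R)) ≫ (rightUnit W).inv = (rightUnit V).inv ≫ f := by
  rw [Iso.comp_inv_eq, Category.assoc, Iso.eq_inv_comp]
  exact hom_ext <| LinearMap.ext fun ξ => by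
    simp only [linear_comp, rightUnit_hom_apply, tensorHom_crossTmul, linear_id]

theorem pentagon (U V W T : D k R) :
    tensorHom (associator U V W).hom (𝟙 T) ≫ (associator U (V.tensor W) T).hom ≫
        tensorHom (𝟙 U) (associator V W T).hom =
      (associator (U.tensor V) W T).hom ≫ (associator U V (W.tensor T)).hom :=
  hom_ext <| tensor_ext_left_left fun _ _ _ _ => by
    simp only [linear_comp, tensorHom_crossTmul, associator_hom_crossTmul, linear_id]

theorem triangle (V W : D k R) :
    (associator V (unit k R) W).hom ≫ tensorHom (𝟙 V) (leftUnit W).inv =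
      tensorHom (rightUnit V).inv (𝟙 W) := by
  refine hom_ext <| tensor_ext_left fun _ ξ _ _ c _ _ ζ _ => ?_
  obtain ⟨r, rfl⟩ := eq_smul_one c
  simp only [map_smul, LinearMap.smul_apply, linear_comp, tensorHom_crossTmul,
    associator_hom_crossTmul, linear_id, rightUnit_inv_crossTmul, leftUnit_inv_crossTmul]

theorem braiding_naturality (f : V ⟶ V') (g : W ⟶ W') :
    tensorHom f g ≫ (braiding V' W').hom = (braiding V W).hom ≫ tensorHom g f :=
  hom_ext <| tensor_ext fun _ _ hξ _ _ _ => by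
    simp only [linear_comp, tensorHom_crossTmul, braiding_hom_crossTmul hξ,
      braiding_hom_crossTmul (linear_mem_homog f hξ), linear_rho]

theorem hexagon_forward (U V W : D k R) :
    (associator U V W).hom ≫ (braiding U (V.tensor W)).hom ≫ (associator V W U).hom =
      tensorHom (braiding U V).hom (𝟙 W) ≫ (associator V U W).hom ≫
        tensorHom (𝟙 V) (braiding U W).hom :=
  hom_ext <| tensor_ext_left fun _ _ hξ _ _ _ _ _ _ => by
    simp only [linear_comp, tensorHom_crossTmul, associator_hom_crossTmul, linear_id,
      braiding_hom_crossTmul hξ, rho_crossTmul]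

theorem hexagon_reverse (U V W : D k R) :
    (associator U V W).inv ≫ (braiding (U.tensor V) W).hom ≫ (associator W U V).inv =
      tensorHom (𝟙 U) (braiding V W).hom ≫ (associator U W V).inv ≫
        tensorHom (braiding U W).hom (𝟙 V) :=
  hom_ext <| tensor_ext_right fun _ _ hξ _ _ hη _ _ _ => by
    simp only [linear_comp, tensorHom_crossTmul, associator_inv_crossTmul, linear_id,
      braiding_hom_crossTmul hξ, braiding_hom_crossTmul hη,
      braiding_hom_crossTmul (crossTmul_mem_homog hξ hη), map_mul, Module.End.mul_apply]

end Coherence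

section BraidedCategory

/-- The tensor product, unit and structure maps of `𝒟`. -/
@[reducible] noncomputable def monoidalStruct (k : Type u) [Field k] (R : LeftCosetReps G) :
    MonoidalCategoryStruct (D k R) where
  tensorObj := tensor
  whiskerLeft V _ _ φ := tensorHom (𝟙 V) φ
  whiskerRight θ W := tensorHom θ (𝟙 W)
  tensorHom := tensorHom
  tensorUnit := unit k R
  associator := associator
  leftUnitor V := (leftUnit V).symm
  rightUnitor V := (rightUnit V).symm

/-- The monoidal category `𝒟`. -/
@[reducible] noncomputable def monoidal (k : Type u) [Field k] (R : LeftCosetReps G) :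
    MonoidalCategory (D k R) :=
  letI := monoidalStruct k R
  MonoidalCategory.ofTensorHom
    (id_tensorHom_id := tensorHom_id_id)
    (id_tensorHom := fun _ _ _ _ => rfl)
    (tensorHom_id := fun _ _ => rfl)
    (tensorHom_comp_tensorHom := tensorHom_comp)
    (associator_naturality := associator_naturality)
    (leftUnitor_naturality := leftUnit_naturality)
    (rightUnitor_naturality := rightUnit_naturality)
    (pentagon := pentagon)
    (triangle := triangle)

/-- The braided category `𝒟`. -/
@[reducible] noncomputable def braided (k : Type u) [Field k] (R : LeftCosetReps G) :
    @BraidedCategory (D k R) _ (monoidal k R) :=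
  letI := monoidal k R
  { braiding := braiding
    braiding_naturality_right := fun V _ _ f => braiding_naturality (𝟙 V) f
    braiding_naturality_left := fun f W => braiding_naturality f (𝟙 W)
    hexagon_forward := hexagon_forward
    hexagon_reverse := hexagon_reverse }

end BraidedCategory

end Tensor

end D

end CosetBraiding

theorem mainTheorem1 {X : Type w} [Group X] [Finite X] (G : Subgroup X) (R : LeftCosetReps G)
    (k : Type u) [Field k] :
    ∃ (hT : ∀ V W : D k R, (V.data.tensor W.data).IsObject) (hk : (Data.unit k R).IsObject),
      let T : D k R → D k R → D k R := fun V W => ⟨V.data.tensor W.data, hT V W⟩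
      let I : D k R := ⟨Data.unit k R, hk⟩
      -- the gradings and actions of `V ⊗ W` on homogeneous elements
      (∀ (V W : D k R) (a b : R.M) (g h : G), ∀ ξ ∈ V.data.gr a g, ∀ η ∈ W.data.gr b h,
        (ξ ⊗ₜ[k] η : T V W) ∈ (T V W).data.gr (R.dot a b) ((R.tau a b)⁻¹ * g * h) ∧
        (∀ u : G, (T V W).data.act u (ξ ⊗ₜ[k] η) =
          V.data.act (R.la b u) ξ ⊗ₜ[k] W.data.act u η) ∧
        (∀ (s c : R.M) (h' : G), W.data.mact (R.ra s g) η ∈ W.data.gr c h' →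
          (T V W).data.mact (R.ra s (R.tau a b)) (ξ ⊗ₜ[k] η) =
            V.data.act (R.tau (R.ra s g) b * (R.tau c (R.ra s (g * h)))⁻¹) (V.data.mact s ξ)
              ⊗ₜ[k] W.data.mact (R.ra s g) η)) ∧
      ∃ (tensorHom : ∀ {V V' W W' : D k R}, (V ⟶ V') → (W ⟶ W') → (T V W ⟶ T V' W'))
        (Φ : ∀ U V W : D k R, T (T U V) W ≅ T U (T V W))
        (l : ∀ V : D k R, V ≅ T V I)
        (r : ∀ V : D k R, V ≅ T I V)
        (Ψ : ∀ V W : D k R, T V W ≅ T W V),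
        (∀ {V V' W W' : D k R} (θ : V ⟶ V') (φ : W ⟶ W') (ξ : V) (η : W),
          D.linear (tensorHom θ φ) (ξ ⊗ₜ[k] η) = D.linear θ ξ ⊗ₜ[k] D.linear φ η) ∧
        (∀ (U V W : D k R) (b c : R.M) (h h' : G) (ξ : U),
          ∀ η ∈ V.data.gr b h, ∀ ζ ∈ W.data.gr c h',
          D.linear (Φ U V W).hom ((ξ ⊗ₜ[k] η) ⊗ₜ[k] ζ) =
            U.data.act (R.tau b c) ξ ⊗ₜ[k] (η ⊗ₜ[k] ζ)) ∧
        (∀ (V : D k R) (ξ : V), D.linear (l V).hom ξ = ξ ⊗ₜ[k] (1 : k)) ∧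
        (∀ (V : D k R) (ξ : V), D.linear (r V).hom ξ = (1 : k) ⊗ₜ[k] ξ) ∧
        (∀ (V W : D k R) (a b : R.M) (g h : G), ∀ ξ ∈ V.data.gr a g, ∀ η ∈ W.data.gr b h,
          D.linear (Ψ V W).hom (ξ ⊗ₜ[k] η) = W.data.mact a η ⊗ₜ[k] V.data.act h ξ) ∧
        -- with these structures, `𝒟` is a braided tensor category
        ∃ (m : MonoidalCategory (D k R)) (b : @BraidedCategory (D k R) _ m),
          @BraidedData.of (D k R) _ m b =
            { tensorObj := T
              whiskerLeft := fun V _ _ φ => tensorHom (𝟙 V) φ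
              whiskerRight := fun θ W => tensorHom θ (𝟙 W)
              tensorHom := tensorHom
              tensorUnit := I
              associator := Φ
              leftUnitor := fun V => (r V).symm
              rightUnitor := fun V => (l V).symm
              braiding := Ψ } := by
  refine ⟨fun V W => (D.tensor V W).isObject, (D.unit k R).isObject, ?_, D.tensorHom,
    D.associator, D.rightUnit, D.leftUnit, D.braiding, fun _ _ _ _ => rfl, ?_, fun _ _ => rfl,
    fun _ _ => rfl, ?_, D.monoidal k R, D.braided k R, rfl⟩
  · intro V W a b g h ξ hξ η hη
    exact ⟨Data.tmul_mem_gr hξ hη, fun u => Data.tensor_act_tmul u ξ hη,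
      fun s c h' hc => Data.tensor_mact_tmul s hξ hη hc⟩
  · intro U V W b c h h' ξ η hη ζ hζ
    exact D.associator_hom_tmul ξ hη hζ
  · intro V W a b g h ξ hξ η hη
    exact D.braiding_hom_tmul hξ hη
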